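/- Let $G$ be a finite connected simple graph with vertex set $V$, $|V| = k \ge 2$, and write $d_v$ for the degree of $v$. The meteor process on $G$ is the process $(\mathcal M_t)_{t\ge 0}$, $\mathcal M_t = (M^x_t)_{x\in V} \in [0,\infty)^V$, defined as follows. Let $N^v$, $v\in V$, be jointly independent Poisson processes with intensity $1$, independent of $\mathcal M_0$. At each jump time $t$ of $N^v$ the mass at $v$ is distributed equally among the neighbours of $v$: $M^v_t = 0$, $M^x_t = M^x_{t-} + M^v_{t-}/d_v$ for every neighbour $x$ of $v$, and $M^x_t = M^x_{t-}$ for all other $x$; between the jump times of the processes $N^v$ the configuration does not change. A probability measure $Q$ on $[0,\infty)^V$ is called stationary if $\mathcal M_t$ has distribution $Q$ for every $t \ge 0$ whenever $\mathcal M_0$ does. Then there is exactly one stationary distribution $Q$ with $\sum_{x\in V} a_x = k$ for $Q$-almost every $a$, and its closed support $U_Q$ in $[0,\infty)^V$ (the set of points all of whose neighbourhoods have positive $Q$-measure) satisfies $$U_Q = \Big\{ a \in [0,\infty)^V : \sum_{x\in V} a_x = k \text{ and } a_x = 0 \text{ for at least one } x\in V\Big\}.$$ -/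

import Mathlib

open MeasureTheory ProbabilityTheory
open scoped NNReal

universe u

/-- A homogeneous Poisson process of intensity `1` on `[0, ∞)`, given through its counting
process: `N t` is the number of points in `(0, t]`. The paths are almost surely nondecreasing,
so the truncated subtraction of `ℕ` in the increments is the true one. -/
structure IsPoissonProcess {Ω : Type u} [MeasurableSpace Ω]
    (N : ℝ≥0 → Ω → ℕ) (μ : Measure Ω) : Prop where
  measurable : ∀ t, Measurable (N t)
  start_zero : ∀ᵐ ω ∂μ, N 0 ω = 0
  monotone : ∀ᵐ ω ∂μ, Monotone fun t => N t ω
  rightContinuous : ∀ᵐ ω ∂μ, ∀ t, ContinuousWithinAt (fun s => N s ω) (Set.Ici t) t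
  indepIncrements : HasIndepIncrements N μ
  law_increments : ∀ s t, s ≤ t →
    HasLaw (fun ω => N t ω - N s ω) (poissonMeasure (t - s)) μ

section Meteor

variable {V : Type u} [Fintype V] [DecidableEq V] (G : SimpleGraph V) [DecidableRel G.Adj]

/-- The effect of a meteor hit at the vertex `v` on the mass configuration `a`: all the mass
at `v` is removed and distributed equally among the neighbours of `v`. -/
noncomputable def meteorHit (a : V → ℝ≥0) (v : V) : V → ℝ≥0 := fun x =>
  if x = v then 0 else if G.Adj v x then a x + a v / (G.degree v : ℝ≥0) else a x

/-- `M` is a meteor process on `G` driven by the meteor arrival processes `N v`, `v ∈ V`: these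
are jointly independent Poisson processes of intensity `1`, independent of the initial
configuration `M 0`. The configuration stays constant on time intervals without hits, and it
changes by `meteorHit G · v` when a hit arrives at `v`. Almost surely there are finitely many hits
in bounded time and no two simultaneous ones, so it suffices to prescribe the change of `M` over
time intervals `(s, t]` that contain no hit, or exactly one hit. -/
structure IsMeteorProcess {Ω : Type u} [MeasurableSpace Ω] (μ : Measure Ω)
    (N : V → ℝ≥0 → Ω → ℕ) (M : ℝ≥0 → Ω → V → ℝ≥0) : Prop where
  isProbabilityMeasure : IsProbabilityMeasure μ
  poisson : ∀ v, IsPoissonProcess (N v) μ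
  indep : iIndepFun (fun v ω t => N v t ω) μ
  measurable : ∀ t, Measurable (M t)
  indep_start : IndepFun (M 0) (fun ω v t => N v t ω) μ
  no_hit : ∀ᵐ ω ∂μ, ∀ s t, s ≤ t → (∀ v, N v t ω = N v s ω) → M t ω = M s ω
  one_hit : ∀ᵐ ω ∂μ, ∀ s t, s ≤ t → ∀ v, N v t ω = N v s ω + 1 →
    (∀ w, w ≠ v → N w t ω = N w s ω) → M t ω = meteorHit G (M s ω) v

/-- `Q` is a stationary distribution of the meteor process on `G`: there is a meteor process
with initial distribution `Q` whose distribution at every time is `Q`. (The initial distribution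
determines the distribution of the meteor process at every time.) -/
def IsMeteorStationary (Q : Measure (V → ℝ≥0)) : Prop :=
  ∃ (Ω : Type u) (_ : MeasurableSpace Ω) (μ : Measure Ω)
    (N : V → ℝ≥0 → Ω → ℕ) (M : ℝ≥0 → Ω → V → ℝ≥0),
    IsMeteorProcess G μ N M ∧ ∀ t, HasLaw (M t) Q μ

/-- `Q` is a stationary distribution of the meteor process on `G` with total mass `|V|`, that is,
with average mass `1` per vertex. -/
def IsNormalizedMeteorStationary (Q : Measure (V → ℝ≥0)) : Prop :=
  IsMeteorStationary G Q ∧ ∀ᵐ a ∂Q, ∑ x, a x = (Fintype.card V : ℝ≥0)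

end Meteor

/-! The Poisson clocks can be removed: a probability measure is stationary if and only if it is
invariant under a hit at a uniformly chosen vertex (`IsMeteorInvariant`). Necessity comes from the
events of at most one hit in a short time (`IsMeteorStationary.isMeteorInvariant`). Sufficiency
comes from an explicit process: a Poisson number of arrivals of rate `|V|` with independent uniform
marks splits into independent rate-one Poisson processes, and each hit preserves the law
(`IsMeteorInvariant.isMeteorStationary`).

Hits are linear, preserve mass, and are dual to replacing the value of a function at a vertex by its
mean over the neighbours. Such averaging never increases oscillation, and `|V|` rounds through all
vertices shrink it by a fixed factor below one (`avgSeq_osc_le_of_rounds`). By duality a suitable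
word of hits contracts the `ℓ¹` distance of configurations of equal mass. The random word contains
this one with positive probability, so the starting point is forgotten
(`exists_abs_hitMean_sub_le`). This gives uniqueness, and it makes every limit point of the laws
after `n` hits invariant, which gives existence.

For the support, a vertex just hit is empty, and having an empty vertex is a closed condition.
Conversely, take a target whose only empty vertex is `v` and whose other masses are rationally
independent. It can be unhit: `v` collects an equal amount from all neighbours until the poorest is
empty, and the result is again generic. A superharmonic potential shows that this backward orbit
visits every vertex infinitely often (`gather_visits_infinitely_often`), so the forward word
contracts all configurations of that mass towards the target. An open null set near the target would
pull back along this word to a null set, although the pullback has full measure. -/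

/-! ### Duality of hits and averaging, and contraction of the `ℓ¹` distance. -/

section Averaging

variable {V : Type u} [Fintype V] [DecidableEq V] (G : SimpleGraph V) [DecidableRel G.Adj]

/-- Replace the value of `f` at `v` by its average over the neighbours of `v`. This is the
operation on functions that is dual to a meteor hit at `v`. -/
noncomputable def avgAt (f : V → ℝ) (v : V) : V → ℝ :=
  Function.update f v ((∑ y ∈ G.neighborFinset v, f y) / G.degree v)

/-- Successive averaging at the vertices `v 0, …, v (n - 1)`. -/
noncomputable def avgSeq (v : ℕ → V) (f : V → ℝ) : ℕ → V → ℝ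
  | 0 => f
  | n + 1 => avgAt G (avgSeq v f n) (v n)

/-- The configuration after hits at `v (n - 1), …, v 0`, in this order of time. -/
noncomputable def hitSeq (v : ℕ → V) : ℕ → (V → ℝ≥0) → V → ℝ≥0
  | 0, a => a
  | n + 1, a => hitSeq v n (meteorHit G a (v n))

/-- The `ℓ¹` distance of two configurations. -/
noncomputable def massDist (a b : V → ℝ≥0) : ℝ := ∑ x, |(a x : ℝ) - b x|

lemma meteorHit_self (a : V → ℝ≥0) (v : V) : meteorHit G a v v = 0 := by
  simp [meteorHit]

lemma coe_meteorHit (a : V → ℝ≥0) (v x : V) : (meteorHit G a v x : ℝ) =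
    a x - (if x = v then (a v : ℝ) else 0) + (if G.Adj v x then (a v : ℝ) / G.degree v else 0) := by
  unfold meteorHit
  by_cases h : x = v
  · subst h; simp
  · by_cases h' : G.Adj v x <;> simp [h, h']

/-- This is the duality on which all contraction estimates rest: the mass `a v` is tested by the
mean of `f` over the neighbours, since that is where it goes. -/
lemma sum_mul_meteorHit (f : V → ℝ) (a : V → ℝ≥0) (v : V) :
    ∑ x, f x * (meteorHit G a v x : ℝ) = ∑ x, avgAt G f v x * a x := by
  have h1 : ∀ x, avgAt G f v x * (a x : ℝ) = f x * a x +
      (if x = v then ((∑ y ∈ G.neighborFinset v, f y) / G.degree v - f v) * a v else 0) := by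
    intro x
    by_cases h : x = v
    · subst h; simp [avgAt]; ring
    · simp [avgAt, h]
  have h2 : ∀ x, f x * (meteorHit G a v x : ℝ) = f x * a x - (if x = v then f v * a v else 0)
      + (if x ∈ G.neighborFinset v then f x * ((a v : ℝ) / G.degree v) else 0) := by
    intro x
    rw [coe_meteorHit]
    by_cases h : x = v
    · subst h; simp
    · by_cases h' : G.Adj v x <;> simp [h, h']; ring
  simp_rw [h1, h2, Finset.sum_add_distrib, Finset.sum_sub_distrib, Finset.sum_ite_mem,
    Finset.sum_ite_eq', Finset.mem_univ, if_true, Finset.univ_inter, ← Finset.sum_mul]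
  ring

/-- Passing to adjoints reverses the order, which is why `hitSeq` hits `v 0` last while `avgSeq`
averages there first. -/
lemma sum_mul_hitSeq (v : ℕ → V) (f : V → ℝ) (n : ℕ) (a : V → ℝ≥0) :
    ∑ x, f x * (hitSeq G v n a x : ℝ) = ∑ x, avgSeq G v f n x * a x := by
  induction n generalizing a with
  | zero => rfl
  | succ n ih => rw [hitSeq, ih, sum_mul_meteorHit, avgSeq]

variable {G}

/-- The neighbour `z` has weight `1 / G.degree v` in the mean, so a better bound `D` at `z` alone
gains the fraction `(C - D) / G.degree v`. -/
lemma avgAt_sub_le {f : V → ℝ} {v w : V} {C D : ℝ} (hd : 0 < G.degree v)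
    (hC : ∀ y, G.Adj v y → |f y - f w| ≤ C)
    {z : V} (hz : G.Adj v z) (hD : |f z - f w| ≤ D) :
    |(∑ y ∈ G.neighborFinset v, f y) / G.degree v - f w| ≤
      C - (C - D) / G.degree v := by
  have hd' : (0 : ℝ) < G.degree v := by exact_mod_cast hd
  have hzm : z ∈ G.neighborFinset v := by simpa using hz
  have e : (∑ y ∈ G.neighborFinset v, f y) / G.degree v - f w =
      (∑ y ∈ G.neighborFinset v, (f y - f w)) / G.degree v := by
    rw [Finset.sum_sub_distrib]
    simp; field_simp
  rw [e, abs_div, abs_of_pos hd', div_le_iff₀ hd', sub_mul, div_mul_cancel₀ _ hd'.ne']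
  calc |∑ y ∈ G.neighborFinset v, (f y - f w)| ≤ ∑ y ∈ G.neighborFinset v, |f y - f w| :=
        Finset.abs_sum_le_sum_abs _ _
    _ = |f z - f w| + ∑ y ∈ (G.neighborFinset v).erase z, |f y - f w| :=
        (Finset.add_sum_erase _ _ hzm).symm
    _ ≤ D + ∑ y ∈ (G.neighborFinset v).erase z, C := by
        gcongr with y hy
        exact hC y (by simpa using (Finset.mem_of_mem_erase hy))
    _ = C * G.degree v - (C - D) := by
        rw [Finset.sum_const, Finset.card_erase_of_mem hzm, G.card_neighborFinset_eq_degree,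
          nsmul_eq_mul, Nat.cast_sub hd]
        push_cast; ring

variable [Nontrivial V] (hG : G.Connected)
include hG

omit [DecidableEq V] in
lemma degree_pos_of_connected (v : V) : 0 < G.degree v :=
  hG.preconnected.degree_pos_of_nontrivial v

omit [DecidableEq V] in
lemma exists_adj_of_connected (v : V) : ∃ z, G.Adj v z := by
  simpa [G.degree_pos_iff_exists_adj] using degree_pos_of_connected hG v

/-- Duality with the constant function `1`, which averaging fixes because no vertex is isolated. -/
lemma sum_meteorHit (a : V → ℝ≥0) (v : V) : ∑ x, meteorHit G a v x = ∑ x, a x := by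
  have h := sum_mul_meteorHit G (fun _ => 1) a v
  have : avgAt G (fun _ => 1) v = fun _ => 1 := by
    have hd : (G.degree v : ℝ) ≠ 0 := by exact_mod_cast (degree_pos_of_connected hG v).ne'
    ext x
    by_cases h : x = v
    · subst h
      simp only [avgAt, Function.update_self, Finset.sum_const, G.card_neighborFinset_eq_degree,
        nsmul_eq_mul, mul_one, div_self hd]
    · simp [avgAt, h]
  rw [this] at h
  simp only [one_mul] at h
  exact_mod_cast h

lemma sum_hitSeq (v : ℕ → V) (n : ℕ) (a : V → ℝ≥0) : ∑ x, hitSeq G v n a x = ∑ x, a x := by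
  induction n generalizing a with
  | zero => rfl
  | succ n ih => rw [hitSeq, ih, sum_meteorHit hG]

lemma avgSeq_osc_le (v : ℕ → V) {f : V → ℝ} {C : ℝ} (hf : ∀ x y, |f x - f y| ≤ C) (n : ℕ) :
    ∀ x y, |avgSeq G v f n x - avgSeq G v f n y| ≤ C := by
  have hC : 0 ≤ C := (abs_nonneg _).trans (hf (Classical.arbitrary V) (Classical.arbitrary V))
  induction n with
  | zero => exact hf
  | succ n ih =>
    have key : ∀ w, |(∑ y ∈ G.neighborFinset (v n), avgSeq G v f n y) / G.degree (v n)
        - avgSeq G v f n w| ≤ C := fun w => by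
      obtain ⟨z, hz⟩ := exists_adj_of_connected hG (v n)
      simpa using avgAt_sub_le (w := w) (degree_pos_of_connected hG _)
        (fun y _ => ih y w) hz (ih z w)
    intro x y
    rw [avgSeq, avgAt]
    by_cases hx : x = v n <;> by_cases hy : y = v n
    · simpa [hx, hy] using hC
    · subst hx; simpa [hy] using key y
    · subst hy; rw [abs_sub_comm]; simpa [hx] using key x
    · simpa [hx, hy] using ih x y

/-- After `j` full rounds of averaging, the values of the function at two vertices at distance at
most `j` differ by at most a fraction of the initial oscillation, however long the rounds are. -/
lemma avgSeq_dist_le (v : ℕ → V) {f : V → ℝ} {C : ℝ} (hf : ∀ x y, |f x - f y| ≤ C)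
    {T : ℕ → ℕ} (hT : ∀ j x, ∃ i, T j ≤ i ∧ i < T (j + 1) ∧ v i = x) (j : ℕ) :
    ∀ n, T j ≤ n → ∀ x y, G.dist x y ≤ j →
      |avgSeq G v f n x - avgSeq G v f n y| ≤ (1 - ((Fintype.card V : ℝ)⁻¹) ^ j) * C := by
  have hC : 0 ≤ C := (abs_nonneg _).trans (hf (Classical.arbitrary V) (Classical.arbitrary V))
  have hk : (1 : ℝ) ≤ Fintype.card V := by exact_mod_cast Fintype.card_pos
  have hk1 : ((Fintype.card V : ℝ)⁻¹) ≤ 1 := inv_le_one_of_one_le₀ hk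
  have hk0 : 0 ≤ ((Fintype.card V : ℝ)⁻¹) := by positivity
  induction j with
  | zero =>
    intro n _ x y hxy
    have : x = y := (hG.dist_eq_zero_iff).1 (Nat.le_zero.1 hxy)
    simp [this]
  | succ j ih =>
    have hpow : ((Fintype.card V : ℝ)⁻¹) ^ (j + 1) ≤ 1 := pow_le_one₀ hk0 hk1
    -- the averaging step at one of the two vertices
    have key : ∀ n, T j ≤ n → ∀ x, v n = x → ∀ y, y ≠ x → G.dist x y ≤ j + 1 →
        |avgSeq G v f (n + 1) x - avgSeq G v f (n + 1) y| ≤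
          (1 - ((Fintype.card V : ℝ)⁻¹) ^ (j + 1)) * C := by
      intro n hn x hx y hyx hxy
      subst hx
      obtain ⟨p, hp⟩ := hG.exists_walk_length_eq_dist (v n) y
      -- The first step of a geodesic leads to a neighbour one closer to `y`, where the bound for
      -- `j` is available; it is the `D` of `avgAt_sub_le`.
      obtain ⟨z, hz, hzy⟩ : ∃ z, G.Adj (v n) z ∧ G.dist z y ≤ j := by
        cases p with
        | nil => exact absurd rfl hyx
        | cons h q =>
          refine ⟨_, h, (G.dist_le q).trans ?_⟩
          simp only [SimpleGraph.Walk.length_cons] at hp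
          omega
      have hd := degree_pos_of_connected hG (v n)
      have := avgAt_sub_le (w := y) hd
        (fun z _ => avgSeq_osc_le hG v hf n z y) hz (ih n hn z y hzy)
      simp only [avgSeq, avgAt, Function.update_self, Function.update_of_ne hyx]
      refine this.trans ?_
      have hdk : ((Fintype.card V : ℝ)⁻¹) ≤ (G.degree (v n) : ℝ)⁻¹ := by
        apply inv_anti₀ (by exact_mod_cast hd)
        exact_mod_cast (G.degree_lt_card_verts _).le
      rw [div_eq_mul_inv, pow_succ]
      have : 0 ≤ ((Fintype.card V : ℝ)⁻¹) ^ j * C := by positivity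
      nlinarith [mul_le_mul_of_nonneg_left hdk this]
    -- Once `x` or `y` has been averaged after time `T j`, the bound persists: it is reproved at
    -- each later averaging at either of them, and other steps leave both values alone.
    have main : ∀ n, T j ≤ n → ∀ x y, G.dist x y ≤ j + 1 →
        (∃ i, T j ≤ i ∧ i < n ∧ (v i = x ∨ v i = y)) →
        |avgSeq G v f n x - avgSeq G v f n y| ≤
          (1 - ((Fintype.card V : ℝ)⁻¹) ^ (j + 1)) * C := by
      intro n hn
      induction n, hn using Nat.le_induction with
      | base => rintro x y - ⟨i, h1, h2, -⟩; omega
      | succ n hn ih' =>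
        rintro x y hxy ⟨i, h1, h2, h3⟩
        by_cases e : x = y
        · subst e
          simpa using mul_nonneg (sub_nonneg.2 hpow) hC
        by_cases hx : v n = x
        · exact key n hn x hx y (Ne.symm e) hxy
        by_cases hy : v n = y
        · rw [abs_sub_comm]
          exact key n hn y hy x e (by rwa [SimpleGraph.dist_comm])
        · have : i < n := by
            rcases Nat.lt_succ_iff_lt_or_eq.1 h2 with h | h
            · exact h
            · subst h; tauto
          simp only [avgSeq, avgAt, Function.update_of_ne (Ne.symm hx),
            Function.update_of_ne (Ne.symm hy)]
          exact ih' x y hxy ⟨i, h1, this, h3⟩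
    intro n hn x y hxy
    obtain ⟨i, h1, h2, h3⟩ := hT j x
    exact main n (by omega) x y hxy ⟨i, h1, by omega, Or.inl h3⟩

/-- The factor by which the oscillation of a function drops in `|V|` full rounds of averaging. -/
lemma avgSeq_osc_le_of_rounds (v : ℕ → V) {f : V → ℝ} {C : ℝ} (hf : ∀ x y, |f x - f y| ≤ C)
    {T : ℕ → ℕ} (hT : ∀ j x, ∃ i, T j ≤ i ∧ i < T (j + 1) ∧ v i = x) :
    ∀ n, T (Fintype.card V) ≤ n → ∀ x y, |avgSeq G v f n x - avgSeq G v f n y| ≤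
      (1 - ((Fintype.card V : ℝ)⁻¹) ^ Fintype.card V) * C := by
  intro n hn x y
  refine avgSeq_dist_le hG v hf hT _ n hn x y ?_
  obtain ⟨p, hp⟩ := hG.exists_isPath x y
  exact (G.dist_le p).trans hp.length_lt.le

omit hG [DecidableEq V] [Nontrivial V] [DecidableRel G.Adj] in
/-- Two configurations of the same mass are integrated almost alike by a function of small
oscillation. -/
lemma abs_sum_mul_sub_le [Nonempty V] {g : V → ℝ} {C : ℝ} (hg : ∀ x y, |g x - g y| ≤ C)
    {a b : V → ℝ≥0} (hab : ∑ x, a x = ∑ x, b x) :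
    |∑ x, g x * a x - ∑ x, g x * b x| ≤ C / 2 * massDist a b := by
  -- Subtracting the midrange of `g` changes nothing for equal masses and halves the bound.
  obtain ⟨M, hM⟩ := Finite.exists_max g
  obtain ⟨m, hm⟩ := Finite.exists_min g
  have hc : ∀ x, |g x - (g M + g m) / 2| ≤ C / 2 := by
    intro x
    have := hg M m
    rw [abs_le] at this ⊢
    constructor <;> linarith [hM x, hm x]
  have hab' : ∑ x, (a x : ℝ) = ∑ x, (b x : ℝ) := by exact_mod_cast hab
  have e : ∑ x, g x * a x - ∑ x, g x * b x =
      ∑ x, (g x - (g M + g m) / 2) * ((a x : ℝ) - b x) := by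
    simp_rw [sub_mul, mul_sub, Finset.sum_sub_distrib, ← Finset.mul_sum, hab']
    ring
  rw [e, massDist, Finset.mul_sum]
  refine (Finset.abs_sum_le_sum_abs _ _).trans (Finset.sum_le_sum fun x _ => ?_)
  rw [abs_mul]
  gcongr
  exact hc x

omit hG in
/-- If averaging along `v` contracts oscillations, then the hits contract mass distances. -/
lemma massDist_hitSeq_le (v : ℕ → V) (n : ℕ) {ρ : ℝ}
    (h : ∀ f : V → ℝ, (∀ x y, |f x - f y| ≤ 2) →
      ∀ x y, |avgSeq G v f n x - avgSeq G v f n y| ≤ ρ * 2)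
    {a b : V → ℝ≥0} (hab : ∑ x, a x = ∑ x, b x) :
    massDist (hitSeq G v n a) (hitSeq G v n b) ≤ ρ * massDist a b := by
  -- The sign function attains the `ℓ¹` norm, and its oscillation is at most `2`.
  set f : V → ℝ := fun x => SignType.sign ((hitSeq G v n a x : ℝ) - hitSeq G v n b x) with hf
  have hs : ∀ z : ℝ, |((SignType.sign z : SignType) : ℝ)| ≤ 1 := by
    intro z
    rcases lt_trichotomy z 0 with h | h | h <;> simp [h]
  have hosc : ∀ x y, |f x - f y| ≤ 2 := by
    intro x y
    have h1 : |f x| ≤ 1 := hs _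
    have h2 : |f y| ≤ 1 := hs _
    linarith [abs_sub (f x) (f y)]
  have e : massDist (hitSeq G v n a) (hitSeq G v n b) =
      ∑ x, avgSeq G v f n x * a x - ∑ x, avgSeq G v f n x * b x := by
    rw [← sum_mul_hitSeq, ← sum_mul_hitSeq, ← Finset.sum_sub_distrib, massDist]
    refine Finset.sum_congr rfl fun x _ => ?_
    rw [← mul_sub, hf]
    exact (sign_mul_self _).symm
  rw [e]
  refine (le_abs_self _).trans ((abs_sum_mul_sub_le (h f hosc) hab).trans_eq ?_)
  ring

lemma massDist_meteorHit_le (v : V) {a b : V → ℝ≥0} (hab : ∑ x, a x = ∑ x, b x) :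
    massDist (meteorHit G a v) (meteorHit G b v) ≤ massDist a b := by
  have := massDist_hitSeq_le (fun _ => v) 1 (ρ := 1)
    (fun f hf => by simpa using avgSeq_osc_le hG (fun _ => v) hf 1) hab
  simpa [hitSeq] using this

/-- There is a finite sequence of hits that strictly contracts mass distances. -/
lemma exists_hitSeq_contraction : ∃ (v : ℕ → V) (n : ℕ) (ρ : ℝ), 0 ≤ ρ ∧ ρ < 1 ∧
    ∀ a b : V → ℝ≥0, ∑ x, a x = ∑ x, b x →
      massDist (hitSeq G v n a) (hitSeq G v n b) ≤ ρ * massDist a b := by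
  have hk : 0 < Fintype.card V := Fintype.card_pos
  have hk' : (1 : ℝ) ≤ Fintype.card V := by exact_mod_cast hk
  -- Cyclic enumeration of the vertices, so that each block of `|V|` steps is a full round.
  let v : ℕ → V := fun i => (Fintype.equivFin V).symm ⟨i % Fintype.card V, Nat.mod_lt _ hk⟩
  have hT : ∀ j x, ∃ i, Fintype.card V * j ≤ i ∧ i < Fintype.card V * (j + 1) ∧ v i = x := by
    intro j x
    have hx := (Fintype.equivFin V x).2
    refine ⟨Fintype.card V * j + Fintype.equivFin V x, by omega, by rw [mul_add]; omega, ?_⟩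
    simp only [v]
    rw [Equiv.symm_apply_eq]
    ext
    simp [Nat.add_mod, Nat.mod_eq_of_lt hx]
  refine ⟨v, Fintype.card V * Fintype.card V,
    1 - ((Fintype.card V : ℝ)⁻¹) ^ Fintype.card V, ?_, ?_, ?_⟩
  · have : ((Fintype.card V : ℝ)⁻¹) ^ Fintype.card V ≤ 1 :=
      pow_le_one₀ (by positivity) (inv_le_one_of_one_le₀ hk')
    linarith
  · have : 0 < ((Fintype.card V : ℝ)⁻¹) ^ Fintype.card V := by positivity
    linarith
  · intro a b hab
    exact massDist_hitSeq_le v _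
      (fun f hf => avgSeq_osc_le_of_rounds hG v hf (T := fun j => Fintype.card V * j) hT _ le_rfl)
      hab

end Averaging

/-! ### Backward orbits of generic configurations. -/

section Reachability

open Filter Topology

variable {V : Type u} [Fintype V] [DecidableEq V] {G : SimpleGraph V} [DecidableRel G.Adj]

lemma avgSeq_add (v : ℕ → V) (f : V → ℝ) (m n : ℕ) :
    avgSeq G v f (m + n) = avgSeq G (fun i => v (m + i)) (avgSeq G v f m) n := by
  induction n with
  | zero => rfl
  | succ n ih => rw [← add_assoc, avgSeq, ih, avgSeq]

omit [Fintype V] [DecidableEq V] in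
lemma exists_rounds [Finite V] {v : ℕ → V} (hv : ∀ x N, ∃ n, N ≤ n ∧ v n = x) :
    ∃ T : ℕ → ℕ, ∀ j x, ∃ i, T j ≤ i ∧ i < T (j + 1) ∧ v i = x := by
  cases nonempty_fintype V
  have : ∀ N, ∃ M, ∀ x, ∃ i, N ≤ i ∧ i < M ∧ v i = x := by
    intro N
    choose n hn using fun x => hv x N
    refine ⟨Finset.univ.sup n + 1, fun x => ⟨n x, (hn x).1, ?_, (hn x).2⟩⟩
    exact Nat.lt_succ_of_le (Finset.le_sup (Finset.mem_univ x))
  choose M hM using this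
  exact ⟨fun j => M^[j] 0, fun j x => by
    simp only [Function.iterate_succ_apply']; exact hM _ x⟩

/-- Averaging along a sequence that visits every vertex infinitely often makes functions
constant in the limit, uniformly in the function. -/
lemma exists_avgSeq_osc_le [Nontrivial V] (hG : G.Connected) (v : ℕ → V)
    (hv : ∀ x N, ∃ n, N ≤ n ∧ v n = x) (r : ℕ) :
    ∃ N, ∀ (f : V → ℝ) (C : ℝ), (∀ x y, |f x - f y| ≤ C) →
      ∀ x y, |avgSeq G v f N x - avgSeq G v f N y| ≤
        (1 - ((Fintype.card V : ℝ)⁻¹) ^ Fintype.card V) ^ r * C := by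
  induction r with
  | zero => exact ⟨0, fun f C hf => by simpa [avgSeq] using hf⟩
  | succ r ih =>
    obtain ⟨N, hN⟩ := ih
    have hv' : ∀ x M, ∃ n, M ≤ n ∧ v (N + n) = x := by
      intro x M
      obtain ⟨n, h1, h2⟩ := hv x (N + M)
      exact ⟨n - N, by omega, by rwa [Nat.add_sub_cancel' (by omega)]⟩
    obtain ⟨T, hT⟩ := exists_rounds hv'
    refine ⟨N + T (Fintype.card V), fun f C hf x y => ?_⟩
    rw [avgSeq_add, pow_succ', mul_assoc]
    exact avgSeq_osc_le_of_rounds hG _ (hN f C hf) hT _ le_rfl x y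

/-- A function on a connected graph that is strictly superharmonic outside `x`. -/
lemma exists_superharmonic [Nontrivial V] (hG : G.Connected) (x : V) :
    ∃ (h : V → ℝ) (c : ℝ), 0 < c ∧ (∀ u, h u ≤ 0) ∧
      ∀ u, u ≠ x → c ≤ ∑ y ∈ G.neighborFinset u, (h u - h y) := by
  have hk : (2 : ℝ) ≤ Fintype.card V := by
    exact_mod_cast Fintype.one_lt_card (α := V)
  set q : ℝ := ((Fintype.card V : ℝ)⁻¹) with hq
  have hq0 : 0 < q := by positivity
  have hq1 : q ≤ 1 / 2 := by rw [hq, inv_eq_one_div]; gcongr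
  have hqk : q * Fintype.card V = 1 := inv_mul_cancel₀ (by positivity)
  -- With `q = 1 / |V|`, the neighbour nearer to `x` contributes `q ^ D * (1 - q)`, and each of the
  -- at most `|V| - 2` others costs at most `q` times that. At least `2 * q * (1 - q) * q ^ D`
  -- remains, and `q ≤ 1 / 2`.
  refine ⟨fun u => - q ^ G.dist u x, q ^ Fintype.card V * q, by positivity,
    fun u => by simpa using by positivity, fun u hu => ?_⟩
  obtain ⟨p, hp⟩ := hG.exists_walk_length_eq_dist u x
  obtain ⟨z, hz, hzy⟩ : ∃ z, G.Adj u z ∧ G.dist z x + 1 = G.dist u x := by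
    cases p with
    | nil => exact absurd rfl hu
    | cons h q =>
      refine ⟨_, h, ?_⟩
      have h1 := G.dist_le q
      have h2 := h.diff_dist_adj (u := x)
      simp only [SimpleGraph.Walk.length_cons] at hp
      rw [G.dist_comm (u := x), G.dist_comm (u := x)] at h2
      omega
  set D := G.dist z x with hD
  have hzm : z ∈ G.neighborFinset u := by simpa using hz
  have hDk : D + 1 ≤ Fintype.card V := by
    obtain ⟨p, hp⟩ := hG.exists_isPath z x
    have := G.dist_le p
    have := hp.length_lt
    omega
  have hle : ∀ y ∈ (G.neighborFinset u).erase z, - (q ^ (D + 1)) * (1 - q) ≤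
      - q ^ G.dist u x - - q ^ G.dist y x := by
    intro y hy
    have hy' : G.Adj u y := by simpa using Finset.mem_of_mem_erase hy
    have : G.dist y x ≤ D + 2 := by
      have h2 := hy'.diff_dist_adj (u := x)
      rw [G.dist_comm (u := x), G.dist_comm (u := x)] at h2
      omega
    have : q ^ (D + 2) ≤ q ^ G.dist y x :=
      pow_le_pow_of_le_one hq0.le (by linarith) this
    rw [← hzy]
    have e : q ^ (D + 2) = q ^ (D + 1) * q := pow_succ _ _
    linarith
  have hsum := Finset.sum_le_sum hle
  rw [Finset.sum_const, Finset.card_erase_of_mem hzm, G.card_neighborFinset_eq_degree,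
    nsmul_eq_mul] at hsum
  beta_reduce
  rw [← hzy] at hsum
  rw [← Finset.add_sum_erase _ _ hzm, ← hzy, ← hD]
  refine le_trans ?_ (add_le_add_right hsum _)
  have hd : ((G.degree u - 1 : ℕ) : ℝ) ≤ Fintype.card V := by
    have := G.degree_lt_card_verts u
    exact_mod_cast (by omega)
  have hd2 : ((G.degree u - 1 : ℕ) : ℝ) * q ≤ 1 - 2 * q := by
    have h1 := G.degree_lt_card_verts u
    have h0 := degree_pos_of_connected hG u
    have : ((G.degree u - 1 : ℕ) : ℝ) + 2 ≤ Fintype.card V := by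
      exact_mod_cast (by omega)
    nlinarith
  have hqD : 0 < q ^ D := by positivity
  have hqDk : q ^ Fintype.card V ≤ q ^ D := pow_le_pow_of_le_one hq0.le (by linarith) (by omega)
  have e : q ^ (D + 1) = q ^ D * q := pow_succ _ _
  rw [e]
  have h3 : (1 - q) * (((G.degree u - 1 : ℕ) : ℝ) * q) ≤ (1 - q) * (1 - 2 * q) :=
    mul_le_mul_of_nonneg_left hd2 (by linarith)
  have h4 : q ^ Fintype.card V * q ≤ q ^ D * q := by gcongr
  have h5 : q ^ D * ((1 - q) * (((G.degree u - 1 : ℕ) : ℝ) * q)) ≤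
      q ^ D * ((1 - q) * (1 - 2 * q)) := by gcongr
  have h6 : q ^ D * q ≤ q ^ D * ((1 - q) * (2 * q)) := by
    gcongr
    nlinarith
  nlinarith

/-- If mass is successively gathered from the neighbours at empty vertices, and never exhausted,
then every vertex is used infinitely often. -/
lemma gather_visits_infinitely_often [Nontrivial V] (hG : G.Connected)
    (A : ℕ → V → ℝ) (v : ℕ → V) (α : ℕ → ℝ) (hα : ∀ n, 0 < α n) (hA : ∀ n u, 0 ≤ A n u)
    (h0 : ∀ n, A n (v n) = 0)
    (hstep : ∀ n u, A (n + 1) u = A n u + (if u = v n then G.degree (v n) * α n else 0)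
      - (if u ∈ G.neighborFinset (v n) then α n else 0)) (x : V) (N : ℕ) :
    ∃ n, N ≤ n ∧ v n = x := by
  classical
  by_contra! hcon
  -- If `x` is not used after time `N`, the mass on the set `W` of vertices used infinitely often
  -- will turn out to be both bounded away from zero and convergent to zero.
  let W : Finset V := Finset.univ.filter fun u => ∀ N, ∃ n, N ≤ n ∧ v n = u
  obtain ⟨T, hT, hTN⟩ : ∃ T, (∀ n, T ≤ n → v n ∈ W) ∧ N ≤ T := by
    have : ∀ u, ∃ N, u ∈ W ∨ ∀ n, N ≤ n → v n ≠ u := by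
      intro u
      by_cases hu : u ∈ W
      · exact ⟨0, Or.inl hu⟩
      · simp only [W, Finset.mem_filter, Finset.mem_univ, true_and, not_forall, not_exists,
          not_and] at hu
        obtain ⟨N, hN⟩ := hu
        exact ⟨N, Or.inr hN⟩
    choose B hB using this
    refine ⟨Finset.univ.sup B + N, fun n hn => ?_, by omega⟩
    have h1 : B (v n) ≤ Finset.univ.sup B := Finset.le_sup (Finset.mem_univ _)
    rcases hB (v n) with h | h
    · exact h
    · exact absurd rfl (h n (by omega))
  obtain ⟨h, c, hc, hneg, hsuper⟩ := exists_superharmonic hG x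
  -- A Lyapunov function: away from `x` each gathering of amount `α n` raises it by at least `c * α
  -- n`, and it stays nonpositive, so the total amount gathered is finite.
  let Φ : ℕ → ℝ := fun n => ∑ u, h u * A n u
  have hΦ : ∀ n, T ≤ n → Φ n + c * α n ≤ Φ (n + 1) := by
    intro n hn
    have e : Φ (n + 1) = Φ n + α n * ∑ y ∈ G.neighborFinset (v n), (h (v n) - h y) := by
      simp only [Φ, hstep, mul_sub, mul_add, Finset.sum_sub_distrib, Finset.sum_add_distrib,
        mul_ite, mul_zero, Finset.sum_ite_eq', Finset.mem_univ, if_true, Finset.sum_ite_mem,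
        Finset.univ_inter, ← Finset.sum_mul, Finset.sum_const, G.card_neighborFinset_eq_degree,
        nsmul_eq_mul]
      ring
    rw [e, mul_comm c]
    gcongr
    · exact (hα n).le
    · exact hsuper _ (hcon n (by omega))
  have hmono : Monotone fun n => Φ (T + n) :=
    monotone_nat_of_le_succ fun n => by
      have := hΦ (T + n) (by omega)
      have := mul_pos hc (hα (T + n))
      rw [← add_assoc]
      linarith
  have hbdd : BddAbove (Set.range fun n => Φ (T + n)) := by
    refine ⟨0, ?_⟩
    rintro _ ⟨n, rfl⟩
    exact Finset.sum_nonpos fun u _ => mul_nonpos_of_nonpos_of_nonneg (hneg u) (hA _ u)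
  have hlim := tendsto_atTop_ciSup hmono hbdd
  set ℓ := ⨆ n, Φ (T + n) with hℓ
  have hloss : ∀ n, T ≤ n → ∀ m, n ≤ m → ∀ u, A n u ≤ A m u + (Φ m - Φ n) / c := by
    intro n hn m hm u
    induction m, hm using Nat.le_induction with
    | base => simp
    | succ m hm ih =>
      have h1 := hΦ m (by omega)
      have h2 : A m u ≤ A (m + 1) u + α m := by
        rw [hstep]
        have := hα m
        have : (0 : ℝ) ≤ if u = v m then G.degree (v m) * α m else 0 := by
          split_ifs <;> positivity
        split_ifs at this ⊢ <;> linarith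
      have h3 : α m ≤ (Φ (m + 1) - Φ m) / c := by
        rw [le_div_iff₀ hc]; linarith
      have h4 : (Φ (m + 1) - Φ n) / c = (Φ (m + 1) - Φ m) / c + (Φ m - Φ n) / c := by ring
      linarith
  -- A vertex of `W` is empty when next used, so its present mass is at most its losses until then,
  -- which the remaining growth of `Φ` controls.
  have hsmall : ∀ n u, u ∈ W → A (T + n) u ≤ (ℓ - Φ (T + n)) / c := by
    intro n u hu
    simp only [W, Finset.mem_filter, Finset.mem_univ, true_and] at hu
    obtain ⟨m, hm, rfl⟩ := hu (T + n)
    have := hloss (T + n) (by omega) m hm (v m)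
    rw [h0, zero_add] at this
    refine this.trans ?_
    gcongr
    obtain ⟨i, rfl⟩ := Nat.exists_eq_add_of_le (show T ≤ m by omega)
    exact le_ciSup hbdd i
  -- The gathering vertex lies in `W`, so `W` receives `G.degree (v n) * α n` and gives up no more
  -- than that.
  have hWmono : Monotone fun n => ∑ u ∈ W, A (T + n) u := by
    refine monotone_nat_of_le_succ fun n => ?_
    have hv := hT (T + n) (by omega)
    rw [← add_assoc]
    simp only [hstep, Finset.sum_sub_distrib, Finset.sum_add_distrib, Finset.sum_ite_eq', hv,
      if_true, Finset.sum_ite_mem, Finset.sum_const, nsmul_eq_mul]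
    have : ((W ∩ G.neighborFinset (v (T + n))).card : ℝ) ≤ G.degree (v (T + n)) := by
      exact_mod_cast Finset.card_le_card Finset.inter_subset_right
    have := mul_le_mul_of_nonneg_right this (hα (T + n)).le
    linarith
  have hpos : 0 < ∑ u ∈ W, A (T + 1) u := by
    refine Finset.sum_pos' (fun u _ => hA _ u) ⟨v T, hT T le_rfl, ?_⟩
    rw [hstep, h0]
    have hd : (0 : ℝ) < G.degree (v T) := by exact_mod_cast degree_pos_of_connected hG (v T)
    simpa using mul_pos hd (hα T)
  have hzero : Tendsto (fun n => ∑ u ∈ W, (ℓ - Φ (T + n)) / c) atTop (𝓝 0) := by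
    have : Tendsto (fun n => ∑ u ∈ W, (ℓ - Φ (T + n)) / c) atTop (𝓝 (∑ u ∈ W, (ℓ - ℓ) / c)) :=
      tendsto_finsetSum _ fun u _ => ((tendsto_const_nhds.sub hlim).div_const c)
    simpa using this
  have : ∑ u ∈ W, A (T + 1) u ≤ 0 := by
    refine ge_of_tendsto hzero ?_
    filter_upwards [eventually_ge_atTop 1] with n hn
    exact (hWmono hn).trans (Finset.sum_le_sum fun u hu => hsmall n u hu)
  linarith

/-- The configuration `a` has its only empty vertex at `v`, and the masses at the other vertices
are linearly independent over the rationals. -/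
def IsGeneric (a : V → ℝ≥0) (v : V) : Prop :=
  a v = 0 ∧ ∀ c : V → ℚ, ∑ u, (c u : ℝ) * a u = 0 → ∀ u, u ≠ v → c u = 0

-- A zero mass outside `v` would satisfy the rational relation given by a unit vector.
omit [DecidableEq V] in
lemma IsGeneric.pos {a : V → ℝ≥0} {v : V} (h : IsGeneric a v) {u : V} (hu : u ≠ v) :
    0 < a u := by
  classical
  rw [pos_iff_ne_zero]
  intro h0
  have := h.2 (Pi.single u 1) (by
    rw [Finset.sum_eq_single u] <;> simp +contextual [h0]) u hu
  simp at this

/-- A generic configuration arises by a hit from another one. -/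
lemma IsGeneric.exists_pred [Nontrivial V] (hG : G.Connected) {a : V → ℝ≥0} {v : V}
    (h : IsGeneric a v) :
    ∃ (x : V) (b : V → ℝ≥0), IsGeneric b x ∧ meteorHit G b v = a ∧ 0 < a x ∧
      ∀ u, (b u : ℝ) = a u + (if u = v then G.degree v * (a x : ℝ) else 0)
        - (if u ∈ G.neighborFinset v then (a x : ℝ) else 0) := by
  have hne : (G.neighborFinset v).Nonempty := by
    obtain ⟨z, hz⟩ := exists_adj_of_connected hG v
    exact ⟨z, by simpa using hz⟩
  -- The largest amount that all neighbours of `v` can give back equally is their least mass; giving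
  -- it back empties `x`.
  obtain ⟨x, hx, hmin⟩ := (G.neighborFinset v).exists_min_image a hne
  have hadj : G.Adj v x := by simpa using hx
  have hd : (G.degree v : ℝ≥0) ≠ 0 := by exact_mod_cast (degree_pos_of_connected hG v).ne'
  let b : V → ℝ≥0 := fun u => if u = v then G.degree v * a x else
    if u ∈ G.neighborFinset v then a u - a x else a u
  have hb : ∀ u, (b u : ℝ) = a u + (if u = v then G.degree v * (a x : ℝ) else 0)
        - (if u ∈ G.neighborFinset v then (a x : ℝ) else 0) := by
    intro u
    by_cases hu : u = v
    · subst hu; simp [b, h.1]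
    · by_cases hu' : u ∈ G.neighborFinset v
      · simp only [b, hu, hu', if_false, if_true, NNReal.coe_sub (hmin u hu')]; ring
      · simp only [b, hu, hu', if_false]; ring
  refine ⟨x, b, ⟨?_, ?_⟩, ?_, h.pos hadj.ne', hb⟩
  · simp [b, hadj.ne', hadj]
  · intro c hc
    -- All transferred amounts are integer multiples of `a x`, so a relation among the masses of `b`
    -- is one among those of `a` with only the coefficient at `x` changed.
    have e : ∑ u, (c u : ℝ) * b u = ∑ u, ((c + Pi.single x (c v * G.degree v
        - ∑ y ∈ G.neighborFinset v, c y) : V → ℚ) u : ℝ) * a u := by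
      have : ∀ u, ((Pi.single x (c v * G.degree v - ∑ y ∈ G.neighborFinset v, c y) : V → ℚ) u : ℝ)
          = if u = x then (c v * G.degree v - ∑ y ∈ G.neighborFinset v, c y : ℝ) else 0 := by
        intro u
        by_cases hu : u = x
        · subst hu; simp
        · simp [hu]
      simp only [Pi.add_apply, Rat.cast_add, Rat.cast_sum, this, add_mul, ite_mul, zero_mul, hb, mul_sub, mul_add,
        mul_ite, mul_zero, Finset.sum_add_distrib, Finset.sum_sub_distrib, Finset.sum_ite_eq',
        Finset.mem_univ, if_true, Finset.sum_ite_mem, Finset.univ_inter, ← Finset.sum_mul]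
      ring
    have key := h.2 _ (e ▸ hc)
    have h1 : ∀ u, u ≠ v → u ≠ x → c u = 0 := by
      intro u hu hux
      simpa [hux] using key u hu
    have h2 : ∑ y ∈ G.neighborFinset v, c y = c x := by
      refine Finset.sum_eq_single x (fun y hy hyx => h1 y ?_ hyx) (fun h => absurd hx h)
      rintro rfl
      simp at hy
    have h3 := key x hadj.ne'
    simp only [h2, Pi.add_apply, Pi.single_eq_same] at h3
    have h4 : c v = 0 := by
      have : c v * G.degree v = 0 := by linarith
      have hd' : (G.degree v : ℚ) ≠ 0 := by exact_mod_cast (degree_pos_of_connected hG v).ne'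
      simpa [hd'] using this
    intro u hu
    by_cases huv : u = v
    · rw [huv, h4]
    · exact h1 u huv hu
  · ext u
    unfold meteorHit
    by_cases hu : u = v
    · subst hu; simp [h.1]
    · by_cases hu' : G.Adj v u
      · have hm : u ∈ G.neighborFinset v := by simpa using hu'
        simp only [hu, hu', hm, b, if_false, if_true]
        rw [mul_div_cancel_left₀ _ hd, tsub_add_cancel_of_le (hmin u hm)]
      · simp [hu, hu', b]

/-- Every configuration of the same mass is brought close to a given generic one by a suitable
sequence of hits. -/
lemma IsGeneric.exists_hitSeq [Nontrivial V] (hG : G.Connected) {a : V → ℝ≥0} {v₀ : V}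
    (h : IsGeneric a v₀) {ε : ℝ} (hε : 0 < ε) :
    ∃ (v : ℕ → V) (n : ℕ), ∀ b : V → ℝ≥0, ∑ x, b x = ∑ x, a x →
      massDist (hitSeq G v n b) a < ε := by
  have hstep : ∀ p : {p : (V → ℝ≥0) × V // IsGeneric p.1 p.2},
      ∃ q : {p : (V → ℝ≥0) × V // IsGeneric p.1 p.2}, meteorHit G q.1.1 p.1.2 = p.1.1 ∧
        ∃ α : ℝ, 0 < α ∧ ∀ u, (q.1.1 u : ℝ) = p.1.1 u +
          (if u = p.1.2 then G.degree p.1.2 * α else 0)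
          - (if u ∈ G.neighborFinset p.1.2 then α else 0) := by
    rintro ⟨⟨a, v⟩, h⟩
    obtain ⟨x, b, h1, h2, h3, h4⟩ := h.exists_pred hG
    exact ⟨⟨⟨b, x⟩, h1⟩, h2, a x, h3, h4⟩
  choose next hnext α hα hα' using hstep
  -- The orbit runs backwards in time: the hits `v (n - 1), …, v 0` bring `s n` to `a`, and bring
  -- any other start close to `a` by contraction.
  let s : ℕ → {p : (V → ℝ≥0) × V // IsGeneric p.1 p.2} := fun n => next^[n] ⟨⟨a, v₀⟩, h⟩
  have hs : ∀ n, s (n + 1) = next (s n) := fun n => Function.iterate_succ_apply' _ _ _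
  let v : ℕ → V := fun n => (s n).1.2
  have hhit : ∀ n, hitSeq G v n (s n).1.1 = a := by
    intro n
    induction n with
    | zero => rfl
    | succ n ih =>
      rw [hitSeq, hs, hnext, ih]
  have hv : ∀ x N, ∃ n, N ≤ n ∧ v n = x :=
    gather_visits_infinitely_often hG (fun n u => ((s n).1.1 u : ℝ)) v (fun n => α (s n))
      (fun n => hα _) (fun n u => NNReal.coe_nonneg _)
      (fun n => by simpa using (s n).2.1)
      (fun n u => by simp only [hs]; exact hα' (s n) u)
  set ρ : ℝ := 1 - ((Fintype.card V : ℝ)⁻¹) ^ Fintype.card V with hρ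
  have hk : (1 : ℝ) ≤ Fintype.card V := by exact_mod_cast Fintype.card_pos
  have hρ0 : 0 ≤ ρ := by
    have : ((Fintype.card V : ℝ)⁻¹) ^ Fintype.card V ≤ 1 :=
      pow_le_one₀ (by positivity) (inv_le_one_of_one_le₀ hk)
    linarith
  have hρ1 : ρ < 1 := by
    have : 0 < ((Fintype.card V : ℝ)⁻¹) ^ Fintype.card V := by positivity
    linarith
  set m : ℝ := ((∑ x, a x : ℝ≥0) : ℝ) with hm
  obtain ⟨r, hr⟩ : ∃ r : ℕ, ρ ^ r * (2 * m) < ε := by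
    have : Tendsto (fun r : ℕ => ρ ^ r * (2 * m)) atTop (𝓝 (0 * (2 * m))) :=
      (tendsto_pow_atTop_nhds_zero_of_lt_one hρ0 hρ1).mul_const _
    rw [zero_mul] at this
    exact (this.eventually_lt_const hε).exists
  obtain ⟨n, hn⟩ := exists_avgSeq_osc_le hG v hv r
  refine ⟨v, n, fun b hb => ?_⟩
  have hsum : ∑ x, (s n).1.1 x = ∑ x, a x := by
    rw [← hhit n, sum_hitSeq hG]
  have h1 := massDist_hitSeq_le v n (fun f hf => hn f 2 hf) (hb.trans hsum.symm)
  rw [hhit] at h1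
  refine h1.trans_lt (lt_of_le_of_lt ?_ hr)
  gcongr
  calc massDist b (s n).1.1 ≤ ∑ x, ((b x : ℝ) + (s n).1.1 x) := by
        refine Finset.sum_le_sum fun x _ => abs_sub_le_iff.2 ⟨?_, ?_⟩ <;>
        linarith [(b x).coe_nonneg, ((s n).1.1 x).coe_nonneg]
    _ = 2 * m := by
        rw [Finset.sum_add_distrib, hm, two_mul]
        nth_rw 1 [← hb]; rw [← hsum]; push_cast; rfl

end Reachability

/-! ### Density of generic configurations. -/

section Density

open Filter Topology

variable {V : Type u} [Fintype V]

/-- The reals have infinite dimension over `ℚ`, and changing signs of basis vectors keeps them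
independent. -/
lemma exists_linearIndependent_pos (ι : Type*) [Finite ι] :
    ∃ e : ι → ℝ, (∀ i, 0 < e i) ∧ LinearIndependent ℚ e := by
  let B := Module.Basis.ofVectorSpace ℚ ℝ
  have : Infinite (Module.Basis.ofVectorSpaceIndex ℚ ℝ) := by
    by_contra hfin
    rw [not_infinite_iff_finite] at hfin
    have : Module.Finite ℚ ℝ := Module.Finite.of_basis B
    have h1 := Module.rank_lt_aleph0 ℚ ℝ
    rw [Real.rank_rat_real] at h1
    exact absurd Cardinal.aleph0_lt_continuum h1.not_gt
  cases nonempty_fintype ι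
  obtain ⟨φ⟩ : Nonempty (ι ↪ Module.Basis.ofVectorSpaceIndex ℚ ℝ) :=
    ⟨(Fintype.equivFin ι).toEmbedding.trans
      (Fin.valEmbedding.trans (Infinite.natEmbedding _))⟩
  have hli : LinearIndependent ℚ (B ∘ φ) := B.linearIndependent.comp φ φ.injective
  refine ⟨fun i => |B (φ i)|, fun i => abs_pos.2 (hli.ne_zero i), ?_⟩
  let w : ι → ℚˣ := fun i => if 0 ≤ B (φ i) then 1 else -1
  convert hli.units_smul w using 1
  ext i
  by_cases h : 0 ≤ B (φ i)
  · simp [w, h, abs_of_nonneg h]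
  · simp [w, h, abs_of_neg (not_le.1 h), Units.smul_def]

/-- Generic configurations are dense among the configurations with an empty vertex. -/
lemma exists_isGeneric_mem_nhds {a : V → ℝ≥0} {v : V} (hv : a v = 0) (ha : 0 < ∑ x, a x)
    {U : Set (V → ℝ≥0)} (hU : U ∈ 𝓝 a) :
    ∃ a' ∈ U, IsGeneric a' v ∧ ∑ x, a' x = ∑ x, a x := by
  classical
  obtain ⟨e, he, hli⟩ := exists_linearIndependent_pos V
  -- The masses are approximated by rational multiples of independent reals, strictly from above so
  -- that the factors are nonzero even where `a u = 0`.
  have hq : ∀ (u : V) (n : ℕ), ∃ q : ℚ, (a u : ℝ) / e u < q ∧ (q : ℝ) < (a u : ℝ) / e u + 1 / ((n : ℝ) + 1) :=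
    fun u n => exists_rat_btwn (by linarith [Nat.one_div_pos_of_nat (α := ℝ) (n := n)])
  choose q hq1 hq2 using hq
  have hqpos : ∀ u n, (0 : ℝ) < q u n := fun u n =>
    lt_of_le_of_lt (div_nonneg (a u).coe_nonneg (he u).le) (hq1 u n)
  have hqlim : ∀ u, Tendsto (fun n => (q u n : ℝ) * e u) atTop (𝓝 (a u)) := by
    intro u
    have h1 : Tendsto (fun n : ℕ => (a u : ℝ) / e u + 1 / ((n : ℝ) + 1)) atTop
        (𝓝 ((a u : ℝ) / e u + 0)) := tendsto_const_nhds.add tendsto_one_div_add_atTop_nhds_zero_nat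
    rw [add_zero] at h1
    have h2 : Tendsto (fun n => (q u n : ℝ)) atTop (𝓝 ((a u : ℝ) / e u)) :=
      tendsto_of_tendsto_of_tendsto_of_le_of_le tendsto_const_nhds h1
        (fun n => (hq1 u n).le) (fun n => (hq2 u n).le)
    have := h2.mul_const (e u)
    rwa [div_mul_cancel₀ _ (he u).ne'] at this
  let b : ℕ → V → ℝ≥0 := fun n u => if u = v then 0 else Real.toNNReal (q u n * e u)
  have hb : Tendsto b atTop (𝓝 a) := by
    refine tendsto_pi_nhds.2 fun u => ?_
    by_cases hu : u = v
    · subst hu; simp [b, hv]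
    · simpa [b, hu, Function.comp_def] using (continuous_real_toNNReal.tendsto _).comp (hqlim u)
  have hbs : Tendsto (fun n => ∑ u, b n u) atTop (𝓝 (∑ u, a u)) :=
    tendsto_finsetSum _ fun u _ => tendsto_pi_nhds.1 hb u
  -- Rescaling restores the total mass; a common factor does not affect rational independence.
  have hlim : Tendsto (fun n u => (∑ x, a x) / (∑ x, b n x) * b n u) atTop (𝓝 a) := by
    refine tendsto_pi_nhds.2 fun u => ?_
    have := (tendsto_const_nhds (x := ∑ x, a x)).div hbs ha.ne' |>.mul (tendsto_pi_nhds.1 hb u)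
    rwa [div_self ha.ne', one_mul] at this
  obtain ⟨n, hn, hpos⟩ := ((hlim.eventually hU).and (hbs.eventually_ne ha.ne')).exists
  refine ⟨_, hn, ⟨by simp [b], fun c hc u hu => ?_⟩, ?_⟩
  · have hs : (((∑ x, a x) / (∑ x, b n x) : ℝ≥0) : ℝ) ≠ 0 := by
      exact_mod_cast div_ne_zero ha.ne' hpos
    have h1 : ∑ u, ((if u = v then 0 else c u * q u n : ℚ)) • e u = 0 := by
      have : (((∑ x, a x) / (∑ x, b n x) : ℝ≥0) : ℝ) *
          ∑ u, ((if u = v then 0 else c u * q u n : ℚ)) • e u = 0 := by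
        rw [← hc, Finset.mul_sum]
        refine Finset.sum_congr rfl fun u _ => ?_
        by_cases hu : u = v
        · simp [hu, b]
        · have : (Real.toNNReal (q u n * e u) : ℝ) = q u n * e u :=
            Real.coe_toNNReal _ (mul_pos (hqpos u n) (he u)).le
          simp only [hu, b, if_false, NNReal.coe_mul, this, Rat.smul_def, Rat.cast_mul]
          ring
      exact (mul_eq_zero.1 this).resolve_left hs
    have h2 := Fintype.linearIndependent_iff.1 hli _ h1 u
    have h3 : q u n ≠ 0 := by exact_mod_cast (hqpos u n).ne'
    simpa [hu, h3] using h2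
  · rw [← Finset.mul_sum, div_mul_cancel₀ _ hpos]

lemma dist_le_massDist (a b : V → ℝ≥0) : dist a b ≤ massDist a b := by
  refine (dist_pi_le_iff (Finset.sum_nonneg fun _ _ => abs_nonneg _)).2 fun x => ?_
  rw [NNReal.dist_eq]
  exact Finset.single_le_sum (f := fun x => |(a x : ℝ) - b x|) (fun _ _ => abs_nonneg _)
    (Finset.mem_univ x)

/-- Near every configuration with an empty vertex there is a generic target that is approached,
from all configurations of the same mass at once, by a suitable sequence of hits. -/
lemma exists_hitSeq_mem_nhds [DecidableEq V] {G : SimpleGraph V} [DecidableRel G.Adj]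
    [Nontrivial V] (hG : G.Connected) {a : V → ℝ≥0} (hv : ∃ x, a x = 0) (ha : 0 < ∑ x, a x)
    {U : Set (V → ℝ≥0)} (hU : U ∈ 𝓝 a) :
    ∃ (v : ℕ → V) (n : ℕ), ∀ b : V → ℝ≥0, ∑ x, b x = ∑ x, a x → hitSeq G v n b ∈ U := by
  obtain ⟨x, hx⟩ := hv
  obtain ⟨a', ha', hgen, hsum⟩ := exists_isGeneric_mem_nhds hx ha (interior_mem_nhds.2 hU)
  obtain ⟨ε, hε, hball⟩ := Metric.isOpen_iff.1 isOpen_interior a' ha'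
  obtain ⟨v, n, h⟩ := hgen.exists_hitSeq hG hε
  refine ⟨v, n, fun b hb => interior_subset (hball ?_)⟩
  exact (dist_le_massDist _ _).trans_lt (h b (hb.trans hsum.symm))

end Density

/-! ### Invariant distributions: support and uniqueness. -/

section Invariant

open Filter Topology

variable {V : Type u} [Fintype V] [DecidableEq V] {G : SimpleGraph V} [DecidableRel G.Adj]

variable (G) in
/-- Invariance of a distribution under a hit at a uniformly chosen vertex. -/
def IsMeteorInvariant (Q : Measure (V → ℝ≥0)) : Prop :=
  (Fintype.card V : ENNReal) • Q = ∑ v, Q.map fun a => meteorHit G a v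

lemma continuous_meteorHit (v : V) : Continuous fun a : V → ℝ≥0 => meteorHit G a v := by
  refine continuous_pi fun x => ?_
  unfold meteorHit
  split_ifs
  · exact continuous_const
  · exact (continuous_apply x).add ((continuous_apply v).div_const _)
  · exact continuous_apply x

lemma measurable_meteorHit (v : V) : Measurable fun a : V → ℝ≥0 => meteorHit G a v :=
  (continuous_meteorHit v).measurable

lemma continuous_hitSeq (v : ℕ → V) (n : ℕ) : Continuous (hitSeq G v n) := by
  induction n with
  | zero => exact continuous_id
  | succ n ih => exact ih.comp (continuous_meteorHit _)

/-- Each image measure is one summand of a multiple of `Q`, hence vanishes where `Q` does. -/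
lemma IsMeteorInvariant.preimage_meteorHit {Q : Measure (V → ℝ≥0)} (hQ : IsMeteorInvariant G Q)
    {B : Set (V → ℝ≥0)} (hB : MeasurableSet B) (h0 : Q B = 0) (v : V) :
    Q ((fun a => meteorHit G a v) ⁻¹' B) = 0 := by
  have h := congrArg (fun μ => μ B) hQ
  simp only [Measure.smul_apply, h0, smul_zero, Measure.finsetSum_apply] at h
  have := Finset.sum_eq_zero_iff.1 h.symm v (Finset.mem_univ v)
  rwa [Measure.map_apply (measurable_meteorHit v) hB] at this

lemma IsMeteorInvariant.preimage_hitSeq {Q : Measure (V → ℝ≥0)} (hQ : IsMeteorInvariant G Q)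
    {B : Set (V → ℝ≥0)} (hB : MeasurableSet B) (h0 : Q B = 0) (v : ℕ → V) (n : ℕ) :
    Q (hitSeq G v n ⁻¹' B) = 0 := by
  induction n with
  | zero => exact h0
  | succ n ih => exact hQ.preimage_meteorHit ((continuous_hitSeq v n).measurable hB) ih (v n)

/-- Every summand in the invariance equation lives on configurations that are empty at the vertex
hit. -/
lemma IsMeteorInvariant.ae_exists_eq_zero [Nonempty V] {Q : Measure (V → ℝ≥0)}
    (hQ : IsMeteorInvariant G Q) : ∀ᵐ a ∂Q, ∃ x, a x = 0 := by
  have hm : MeasurableSet {a : V → ℝ≥0 | ∃ x, a x = 0}ᶜ := by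
    have : {a : V → ℝ≥0 | ∃ x, a x = 0} = ⋃ x, {a | a x = 0} := by ext; simp
    rw [this]
    exact (MeasurableSet.iUnion fun x =>
      measurableSet_eq_fun (measurable_pi_apply x) measurable_const).compl
  have h := congrArg (fun μ => μ {a : V → ℝ≥0 | ∃ x, a x = 0}ᶜ) hQ
  have h0 : ∀ v, (Q.map fun a => meteorHit G a v) {a : V → ℝ≥0 | ∃ x, a x = 0}ᶜ = 0 := by
    intro v
    rw [Measure.map_apply (measurable_meteorHit v) hm]
    convert measure_empty (μ := Q)
    ext a
    simpa using ⟨v, meteorHit_self G a v⟩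
  simp only [Measure.smul_apply, Measure.finsetSum_apply, h0, Finset.sum_const_zero,
    smul_eq_mul] at h
  exact (mul_eq_zero.1 h).resolve_left (by simp)

/-- The support of an invariant distribution. -/
theorem IsMeteorInvariant.support_eq [Nontrivial V] (hG : G.Connected) {Q : Measure (V → ℝ≥0)}
    [IsProbabilityMeasure Q] (hQ : IsMeteorInvariant G Q)
    (hmass : ∀ᵐ a ∂Q, ∑ x, a x = (Fintype.card V : ℝ≥0)) :
    Q.support = {a | ∑ x, a x = (Fintype.card V : ℝ≥0) ∧ ∃ x, a x = 0} := by
  apply Set.Subset.antisymm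
  · refine Measure.support_subset_of_isClosed ?_ (hmass.and hQ.ae_exists_eq_zero)
    have h1 : IsClosed {a : V → ℝ≥0 | ∑ x, a x = (Fintype.card V : ℝ≥0)} :=
      isClosed_eq (by fun_prop) continuous_const
    have h2 : IsClosed {a : V → ℝ≥0 | ∃ x, a x = 0} := by
      have : {a : V → ℝ≥0 | ∃ x, a x = 0} = ⋃ x, {a | a x = 0} := by ext; simp
      rw [this]
      exact isClosed_iUnion_of_finite fun x => isClosed_eq (continuous_apply x) continuous_const
    exact h1.inter h2
  · rintro a ⟨ha, hx⟩
    rw [Measure.mem_support_iff_forall]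
    intro U hU
    have hpos : 0 < ∑ x, a x := by rw [ha]; exact_mod_cast Fintype.card_pos
    obtain ⟨v, n, h⟩ := exists_hitSeq_mem_nhds hG hx hpos (interior_mem_nhds.2 hU)
    refine lt_of_lt_of_le (pos_iff_ne_zero.2 fun h0 => ?_) (measure_mono interior_subset)
    have h1 := hQ.preimage_hitSeq isOpen_interior.measurableSet h0 v n
    have h2 : ∀ᵐ b ∂Q, b ∈ hitSeq G v n ⁻¹' interior U := by
      filter_upwards [hmass] with b hb using h b (hb.trans ha.symm)
    have h3 : ∀ᵐ b ∂Q, b ∉ hitSeq G v n ⁻¹' interior U := measure_eq_zero_iff_ae_notMem.1 h1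
    obtain ⟨b, hb, hb'⟩ := (h2.and h3).exists
    exact hb' hb

/-- The mean of `f` after a hit at a uniformly chosen vertex. -/
noncomputable def hitMean (G : SimpleGraph V) [DecidableRel G.Adj] (f : (V → ℝ≥0) → ℝ) :
    (V → ℝ≥0) → ℝ :=
  fun a => (∑ v, f (meteorHit G a v)) / Fintype.card V

lemma hitMean_bound [Nonempty V] {f : (V → ℝ≥0) → ℝ} {C : ℝ} (hf : ∀ a, |f a| ≤ C) (n : ℕ) :
    ∀ a, |(hitMean G)^[n] f a| ≤ C := by
  have hk : (0 : ℝ) < Fintype.card V := by exact_mod_cast Fintype.card_pos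
  induction n with
  | zero => exact hf
  | succ n ih =>
    intro a
    rw [Function.iterate_succ_apply', hitMean, abs_div, abs_of_pos hk, div_le_iff₀ hk]
    refine (Finset.abs_sum_le_sum_abs _ _).trans
      ((Finset.sum_le_sum fun v _ => ih (meteorHit G a v)).trans_eq ?_)
    simp [mul_comm]

lemma continuous_hitMean {f : (V → ℝ≥0) → ℝ} (hf : Continuous f) (n : ℕ) :
    Continuous ((hitMean G)^[n] f) := by
  induction n with
  | zero => exact hf
  | succ n ih =>
    rw [Function.iterate_succ_apply']
    exact (continuous_finsetSum _ fun v _ => ih.comp (continuous_meteorHit v)).div_const _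

omit [DecidableEq V] in
lemma integrable_of_continuous_bounded {Q : Measure (V → ℝ≥0)} [IsFiniteMeasure Q]
    {f : (V → ℝ≥0) → ℝ} (hf : Continuous f) {C : ℝ} (hC : ∀ a, |f a| ≤ C) : Integrable f Q :=
  Integrable.of_bound hf.measurable.aestronglyMeasurable C (ae_of_all _ hC)

lemma integral_hitMean {Q : Measure (V → ℝ≥0)} [IsFiniteMeasure Q]
    {f : (V → ℝ≥0) → ℝ} (hf : Continuous f) {C : ℝ} (hC : ∀ a, |f a| ≤ C) :
    ∫ a, hitMean G f a ∂Q = (∑ v, ∫ a, f a ∂(Q.map fun a => meteorHit G a v)) / Fintype.card V := by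
  unfold hitMean
  rw [integral_div, integral_finsetSum]
  · congr 1
    refine Finset.sum_congr rfl fun v _ => ?_
    rw [integral_map (measurable_meteorHit v).aemeasurable hf.measurable.aestronglyMeasurable]
  · intro v _
    exact integrable_of_continuous_bounded (hf.comp (continuous_meteorHit v)) fun a => hC _

lemma IsMeteorInvariant.integral_hitMean [Nonempty V] {Q : Measure (V → ℝ≥0)} [IsFiniteMeasure Q]
    (hQ : IsMeteorInvariant G Q) {f : (V → ℝ≥0) → ℝ} (hf : Continuous f) {C : ℝ}
    (hC : ∀ a, |f a| ≤ C) (n : ℕ) : ∫ a, (hitMean G)^[n] f a ∂Q = ∫ a, f a ∂Q := by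
  have hk : (0 : ℝ) < Fintype.card V := by exact_mod_cast Fintype.card_pos
  induction n with
  | zero => rfl
  | succ n ih =>
    have hc := continuous_hitMean (G := G) hf n
    have hb := hitMean_bound (G := G) hC n
    rw [Function.iterate_succ_apply', _root_.integral_hitMean hc hb, ← ih,
      ← integral_finsetSum_measure, ← hQ, integral_smul_measure]
    · simp only [ENNReal.toReal_natCast, smul_eq_mul]
      field_simp
    · intro v _
      have : IsFiniteMeasure (Q.map fun a => meteorHit G a v) := inferInstance
      exact integrable_of_continuous_bounded hc hb

/-- Taking means after `n` random hits improves Lipschitz constants as soon as some sequence of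
`n` hits contracts. -/
lemma abs_hitMean_sub_le [Nontrivial V] (hG : G.Connected) {f : (V → ℝ≥0) → ℝ} {L : ℝ}
    (hL : 0 ≤ L) {m : ℝ≥0}
    (hf : ∀ a b : V → ℝ≥0, ∑ x, a x = m → ∑ x, b x = m → |f a - f b| ≤ L * massDist a b)
    (v : ℕ → V) (n : ℕ) : ∀ a b : V → ℝ≥0, ∑ x, a x = m → ∑ x, b x = m →
      |(hitMean G)^[n] f a - (hitMean G)^[n] f b| ≤
        L * ((1 - ((Fintype.card V : ℝ)⁻¹) ^ n) * massDist a b +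
          ((Fintype.card V : ℝ)⁻¹) ^ n * massDist (hitSeq G v n a) (hitSeq G v n b)) := by
  have hk : (0 : ℝ) < Fintype.card V := by exact_mod_cast Fintype.card_pos
  have hk1 : (1 : ℝ) ≤ Fintype.card V := by exact_mod_cast Fintype.card_pos (α := V)
  have hq1 : ∀ n, ((Fintype.card V : ℝ)⁻¹) ^ n ≤ 1 := fun n =>
    pow_le_one₀ (by positivity) (inv_le_one_of_one_le₀ hk1)
  -- words other than `v` do not expand
  have hnonexp : ∀ n, ∀ a b : V → ℝ≥0, ∑ x, a x = m → ∑ x, b x = m →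
      |(hitMean G)^[n] f a - (hitMean G)^[n] f b| ≤ L * massDist a b := by
    intro n
    induction n with
    | zero => exact hf
    | succ n ih =>
      intro a b ha hb
      rw [Function.iterate_succ_apply', hitMean, hitMean, ← sub_div, ← Finset.sum_sub_distrib,
        abs_div, abs_of_pos hk, div_le_iff₀ hk]
      refine (Finset.abs_sum_le_sum_abs _ _).trans ((Finset.sum_le_sum fun u _ =>
        (ih _ _ ((sum_meteorHit hG a u).trans ha) ((sum_meteorHit hG b u).trans hb)).trans
          (mul_le_mul_of_nonneg_left (massDist_meteorHit_le hG u (ha.trans hb.symm)) hL)).trans_eq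
            ?_)
      simp [mul_comm]
  induction n with
  | zero => intro a b ha hb; simpa [hitSeq] using hf a b ha hb
  | succ n ih =>
    intro a b ha hb
    rw [Function.iterate_succ_apply', hitMean, hitMean, ← sub_div, ← Finset.sum_sub_distrib,
      abs_div, abs_of_pos hk, div_le_iff₀ hk]
    refine (Finset.abs_sum_le_sum_abs _ _).trans ?_
    -- The outermost mean is the earliest hit, as is `v n` in `hitSeq`; this term carries the
    -- contraction and the others are only nonexpanding.
    rw [← Finset.add_sum_erase _ _ (Finset.mem_univ (v n))]
    have h1 := ih _ _ ((sum_meteorHit hG a (v n)).trans ha) ((sum_meteorHit hG b (v n)).trans hb)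
    have h2 : ∑ u ∈ Finset.univ.erase (v n), |(hitMean G)^[n] f (meteorHit G a u) -
        (hitMean G)^[n] f (meteorHit G b u)| ≤ (Fintype.card V - 1) * (L * massDist a b) := by
      refine (Finset.sum_le_sum fun u _ =>
        (hnonexp n _ _ ((sum_meteorHit hG a u).trans ha) ((sum_meteorHit hG b u).trans hb)).trans
          (mul_le_mul_of_nonneg_left (massDist_meteorHit_le hG u (ha.trans hb.symm)) hL)).trans_eq
            ?_
      rw [Finset.sum_const, Finset.card_erase_of_mem (Finset.mem_univ _), nsmul_eq_mul,
        Finset.card_univ, Nat.cast_sub Fintype.card_pos]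
      simp
    have h3 : (1 - ((Fintype.card V : ℝ)⁻¹) ^ n) *
        massDist (meteorHit G a (v n)) (meteorHit G b (v n)) ≤
        (1 - ((Fintype.card V : ℝ)⁻¹) ^ n) * massDist a b :=
      mul_le_mul_of_nonneg_left (massDist_meteorHit_le hG _ (ha.trans hb.symm))
        (sub_nonneg.2 (hq1 n))
    have h4 := mul_le_mul_of_nonneg_left h3 hL
    have e : ((Fintype.card V : ℝ)⁻¹) ^ (n + 1) * Fintype.card V = ((Fintype.card V : ℝ)⁻¹) ^ n := by
      rw [pow_succ, mul_assoc, inv_mul_cancel₀ hk.ne', mul_one]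
    rw [mul_assoc, add_mul, mul_right_comm, sub_mul, e, mul_right_comm, e]
    simp only [hitSeq]
    nlinarith

/-- Under random hits, the initial configuration is forgotten. -/
lemma exists_abs_hitMean_sub_le [Nontrivial V] (hG : G.Connected) {f : (V → ℝ≥0) → ℝ} {L : ℝ}
    (hL : 0 ≤ L) {m : ℝ≥0}
    (hf : ∀ a b : V → ℝ≥0, ∑ x, a x = m → ∑ x, b x = m → |f a - f b| ≤ L * massDist a b)
    {ε : ℝ} (hε : 0 < ε) :
    ∃ N, ∀ n, N ≤ n → ∀ a b : V → ℝ≥0, ∑ x, a x = m → ∑ x, b x = m →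
      |(hitMean G)^[n] f a - (hitMean G)^[n] f b| ≤ ε := by
  have hk : (0 : ℝ) < Fintype.card V := by exact_mod_cast Fintype.card_pos
  obtain ⟨v, n₀, ρ, hρ0, hρ1, hρ⟩ := exists_hitSeq_contraction hG
  set q : ℝ := ((Fintype.card V : ℝ)⁻¹) ^ n₀
  have hq0 : 0 < q := by positivity
  have hq1 : q ≤ 1 := pow_le_one₀ (by positivity)
    (inv_le_one_of_one_le₀ (by exact_mod_cast Fintype.card_pos (α := V)))
  -- With probability `q` the next `n₀` hits spell the contracting word; otherwise distances do not
  -- grow.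
  set σ : ℝ := 1 - q + q * ρ with hσ
  have hσ0 : 0 ≤ σ := by have := mul_nonneg hq0.le hρ0; linarith
  have hσ1 : σ < 1 := by have := mul_lt_mul_of_pos_left hρ1 hq0; linarith
  have hiter : ∀ r : ℕ, ∀ a b : V → ℝ≥0, ∑ x, a x = m → ∑ x, b x = m →
      |(hitMean G)^[r * n₀] f a - (hitMean G)^[r * n₀] f b| ≤ L * σ ^ r * massDist a b := by
    intro r
    induction r with
    | zero => intro a b ha hb; simpa using hf a b ha hb
    | succ r ih =>
      intro a b ha hb
      rw [add_mul, one_mul, add_comm, Function.iterate_add_apply]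
      refine (abs_hitMean_sub_le hG (by positivity) ih v n₀ a b ha hb).trans ?_
      rw [pow_succ, ← mul_assoc, mul_assoc (L * σ ^ r) σ]
      refine mul_le_mul_of_nonneg_left ?_ (by positivity)
      have := mul_le_mul_of_nonneg_left (hρ a b (ha.trans hb.symm)) hq0.le
      rw [hσ]
      linarith
  obtain ⟨r, hr⟩ : ∃ r : ℕ, L * σ ^ r * (2 * m) ≤ ε := by
    have : Tendsto (fun r : ℕ => L * σ ^ r * (2 * m)) atTop (𝓝 (L * 0 * (2 * m))) :=
      ((tendsto_pow_atTop_nhds_zero_of_lt_one hσ0 hσ1).const_mul L).mul_const _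
    rw [mul_zero, zero_mul] at this
    exact ((this.eventually_lt_const hε).exists).imp fun _ => le_of_lt
  have hdiam : ∀ a b : V → ℝ≥0, ∑ x, a x = m → ∑ x, b x = m → massDist a b ≤ 2 * m := by
    intro a b ha hb
    calc massDist a b ≤ ∑ x, ((a x : ℝ) + b x) := by
          refine Finset.sum_le_sum fun x _ => abs_sub_le_iff.2 ⟨?_, ?_⟩ <;>
          linarith [(a x).coe_nonneg, (b x).coe_nonneg]
      _ = 2 * m := by
          rw [Finset.sum_add_distrib, two_mul]
          nth_rw 1 [← ha]; rw [← hb]; push_cast; rfl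
  refine ⟨r * n₀, fun n hn => ?_⟩
  induction n, hn using Nat.le_induction with
  | base =>
    intro a b ha hb
    refine (hiter r a b ha hb).trans (le_trans ?_ hr)
    exact mul_le_mul_of_nonneg_left (hdiam a b ha hb) (by positivity)
  | succ n _ ih =>
    intro a b ha hb
    rw [Function.iterate_succ_apply', hitMean, hitMean, ← sub_div, ← Finset.sum_sub_distrib,
      abs_div, abs_of_pos hk, div_le_iff₀ hk]
    refine (Finset.abs_sum_le_sum_abs _ _).trans ((Finset.sum_le_sum fun u _ =>
      ih _ _ ((sum_meteorHit hG a u).trans ha) ((sum_meteorHit hG b u).trans hb)).trans_eq ?_)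
    simp [mul_comm]

omit [Fintype V] [DecidableEq V] in
/-- Bounded Lipschitz functions determine a probability measure. -/
lemma measure_ext_of_lipschitz {X : Type*} [MeasurableSpace X] [PseudoEMetricSpace X]
    [BorelSpace X] {Q Q' : Measure X} [IsProbabilityMeasure Q]
    [IsProbabilityMeasure Q']
    (h : ∀ f : X → ℝ, (∃ C : ℝ, ∀ a, |f a| ≤ C) → (∃ L, LipschitzWith L f) →
      ∫ a, f a ∂Q = ∫ a, f a ∂Q') : Q = Q' := by
  let P : ProbabilityMeasure X := ⟨Q, ‹_›⟩
  let P' : ProbabilityMeasure X := ⟨Q', ‹_›⟩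
  -- Bounded Lipschitz functions determine weak convergence, so the constant sequence `P` also
  -- converges to `P'`, and limits are unique.
  have h1 : Tendsto (fun _ : ℕ => P) atTop (𝓝 P') := by
    rw [tendsto_iff_forall_lipschitz_integral_tendsto]
    rintro f ⟨C, hC⟩ hL
    have : ∫ ω, f ω ∂P = ∫ ω, f ω ∂P' := by
      rcases isEmpty_or_nonempty X with _ | ⟨⟨x₀⟩⟩
      · exact h f ⟨0, fun a => isEmptyElim a⟩ hL
      · refine h f ⟨C + |f x₀|, fun a => ?_⟩ hL
        have := hC a x₀
        rw [Real.dist_eq] at this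
        linarith [abs_sub_abs_le_abs_sub (f a) (f x₀)]
    rw [this]
    exact tendsto_const_nhds
  have h2 : P = P' := tendsto_nhds_unique tendsto_const_nhds h1
  exact congrArg Subtype.val h2

omit [DecidableEq V] in
lemma abs_sub_le_of_lipschitz {f : (V → ℝ≥0) → ℝ} {L : ℝ≥0} (hf : LipschitzWith L f)
    (a b : V → ℝ≥0) : |f a - f b| ≤ L * massDist a b := by
  rw [← Real.dist_eq]
  exact (hf.dist_le_mul a b).trans
    (mul_le_mul_of_nonneg_left (dist_le_massDist a b) L.coe_nonneg)

/-- There is at most one invariant distribution of given mass. -/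
theorem IsMeteorInvariant.unique [Nontrivial V] (hG : G.Connected) {m : ℝ≥0}
    {Q Q' : Measure (V → ℝ≥0)} [IsProbabilityMeasure Q] [IsProbabilityMeasure Q']
    (hQ : IsMeteorInvariant G Q) (hQ' : IsMeteorInvariant G Q')
    (hm : ∀ᵐ a ∂Q, ∑ x, a x = m) (hm' : ∀ᵐ a ∂Q', ∑ x, a x = m) : Q = Q' := by
  refine measure_ext_of_lipschitz fun f ⟨C, hC⟩ ⟨L, hL⟩ => ?_
  obtain ⟨b, hb⟩ := hm.exists
  refine eq_of_forall_dist_le fun ε hε => ?_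
  obtain ⟨N, hN⟩ := exists_abs_hitMean_sub_le hG L.coe_nonneg (m := m)
    (fun a b _ _ => abs_sub_le_of_lipschitz hL a b) (half_pos hε)
  have hc := continuous_hitMean (G := G) hL.continuous N
  have hbd := hitMean_bound (G := G) hC N
  have key : ∀ ν : Measure (V → ℝ≥0), IsProbabilityMeasure ν → (∀ᵐ a ∂ν, ∑ x, a x = m) →
      |∫ a, (hitMean G)^[N] f a ∂ν - (hitMean G)^[N] f b| ≤ ε / 2 := by
    intro ν _ hν
    have e : ∫ a, (hitMean G)^[N] f a ∂ν - (hitMean G)^[N] f b =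
        ∫ a, ((hitMean G)^[N] f a - (hitMean G)^[N] f b) ∂ν := by
      rw [integral_sub (integrable_of_continuous_bounded hc hbd) (integrable_const _)]
      simp
    rw [e, ← Real.norm_eq_abs]
    refine (norm_integral_le_of_norm_le_const (C := ε / 2) ?_).trans_eq (by simp)
    filter_upwards [hν] with a ha using hN N le_rfl a b ha hb
  have h1 := key Q ‹_› hm
  have h2 := key Q' ‹_› hm'
  rw [hQ.integral_hitMean hL.continuous hC] at h1
  rw [hQ'.integral_hitMean hL.continuous hC] at h2
  rw [Real.dist_eq]
  rw [abs_le] at h1 h2 ⊢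
  constructor <;> linarith [h1.1, h1.2, h2.1, h2.2]

end Invariant

/-! ### Existence of an invariant distribution. -/

section Existence

open Filter Topology

variable {V : Type u} [Fintype V] [DecidableEq V] {G : SimpleGraph V} [DecidableRel G.Adj]

/-- The distribution after a hit at a uniformly chosen vertex. -/
noncomputable def hitStep (G : SimpleGraph V) [DecidableRel G.Adj] (μ : Measure (V → ℝ≥0)) :
    Measure (V → ℝ≥0) :=
  (Fintype.card V : ENNReal)⁻¹ • ∑ v, μ.map fun a => meteorHit G a v

lemma isMeteorInvariant_iff [Nonempty V] {Q : Measure (V → ℝ≥0)} :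
    IsMeteorInvariant G Q ↔ hitStep G Q = Q := by
  have h0 : (Fintype.card V : ENNReal) ≠ 0 := by simp
  unfold IsMeteorInvariant hitStep
  constructor
  · intro h
    rw [← h, smul_smul, ENNReal.inv_mul_cancel h0 (ENNReal.natCast_ne_top _), one_smul]
  · intro h
    nth_rw 1 [← h]
    rw [smul_smul, ENNReal.mul_inv_cancel h0 (ENNReal.natCast_ne_top _), one_smul]

lemma isProbabilityMeasure_hitStep [Nonempty V] {μ : Measure (V → ℝ≥0)} [IsProbabilityMeasure μ] :
    IsProbabilityMeasure (hitStep G μ) := by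
  constructor
  have h : ∀ v, (μ.map fun a => meteorHit G a v) Set.univ = 1 := fun v => by
    rw [Measure.map_apply (measurable_meteorHit v) MeasurableSet.univ]; simp
  simp only [hitStep, Measure.smul_apply, Measure.finsetSum_apply, h, Finset.sum_const,
    smul_eq_mul, nsmul_eq_mul, mul_one, Finset.card_univ]
  exact ENNReal.inv_mul_cancel (by simp) (ENNReal.natCast_ne_top _)

/-- Moves the evolution of laws onto test functions, where forgetting was proved. -/
lemma integral_hitStep {μ : Measure (V → ℝ≥0)} [IsFiniteMeasure μ]
    {f : (V → ℝ≥0) → ℝ} (hf : Continuous f) {C : ℝ} (hC : ∀ a, |f a| ≤ C) :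
    ∫ a, f a ∂(hitStep G μ) = ∫ a, hitMean G f a ∂μ := by
  rw [hitStep, integral_smul_measure, integral_finsetSum_measure, integral_hitMean hf hC]
  · simp only [ENNReal.toReal_inv, ENNReal.toReal_natCast, smul_eq_mul]
    ring
  · intro v _
    have : IsFiniteMeasure (μ.map fun a => meteorHit G a v) := inferInstance
    exact integrable_of_continuous_bounded hf hC

/-- There is an invariant distribution of mass `|V|`. -/
theorem exists_isMeteorInvariant [Nontrivial V] (hG : G.Connected) :
    ∃ Q : Measure (V → ℝ≥0), IsProbabilityMeasure Q ∧ IsMeteorInvariant G Q ∧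
      ∀ᵐ a ∂Q, ∑ x, a x = (Fintype.card V : ℝ≥0) := by
  have hk : (0 : ℝ) < Fintype.card V := by exact_mod_cast Fintype.card_pos
  set m : ℝ≥0 := (Fintype.card V : ℝ≥0) with hm
  let E : Set (V → ℝ≥0) := {a | ∑ x, a x = m}
  have hEc : IsClosed E := isClosed_eq (by fun_prop) continuous_const
  have hE : IsCompact E := by
    refine (isCompact_univ_pi fun _ : V => isCompact_Icc (a := (0 : ℝ≥0)) (b := m)).of_isClosed_subset
      hEc fun a ha x _ => ⟨zero_le, ?_⟩
    rw [← show ∑ x, a x = m from ha]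
    exact Finset.single_le_sum (fun _ _ => zero_le) (Finset.mem_univ x)
  let b₀ : V → ℝ≥0 := fun _ => 1
  have hb₀ : ∑ x, b₀ x = m := by simp [b₀, hm]
  let μ : ℕ → Measure (V → ℝ≥0) := fun n => (hitStep G)^[n] (Measure.dirac b₀)
  have hμs : ∀ n, μ (n + 1) = hitStep G (μ n) := fun n => Function.iterate_succ_apply' _ _ _
  have hμp : ∀ n, IsProbabilityMeasure (μ n) := by
    intro n
    induction n with
    | zero => exact (inferInstance : IsProbabilityMeasure (Measure.dirac b₀))
    | succ n ih => rw [hμs]; exact isProbabilityMeasure_hitStep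
  have hμE : ∀ n, μ n Eᶜ = 0 := by
    intro n
    induction n with
    | zero =>
      simp only [μ, Function.iterate_zero, id]
      rw [Measure.dirac_apply' _ hEc.measurableSet.compl]
      simp [E, hb₀]
    | succ n ih =>
      have h : ∀ v, ((μ n).map fun a => meteorHit G a v) Eᶜ = 0 := fun v => by
        rw [Measure.map_apply (measurable_meteorHit v) hEc.measurableSet.compl]
        convert ih using 2
        ext a
        simp [E, sum_meteorHit hG]
      simp only [hμs, hitStep, Measure.smul_apply, Measure.finsetSum_apply, h,
        Finset.sum_const_zero, smul_zero]
  have hint : ∀ n (f : (V → ℝ≥0) → ℝ), Continuous f → ∀ C, (∀ a, |f a| ≤ C) →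
      ∫ a, f a ∂(μ n) = (hitMean G)^[n] f b₀ := by
    intro n
    induction n with
    | zero =>
      intro f hf C hC
      simp only [μ, Function.iterate_zero, id]
      exact integral_dirac _ _
    | succ n ih =>
      intro f hf C hC
      rw [hμs, integral_hitStep hf hC, Function.iterate_succ_apply]
      exact ih _ (continuous_hitMean hf 1) C (hitMean_bound hC 1)
  let P : ℕ → ProbabilityMeasure (V → ℝ≥0) := fun n => ⟨μ n, hμp n⟩
  -- Tightness is automatic, since all laws live on the compact simplex `E`; constant `K` and `u =
  -- 0` express this.
  have hS := isCompact_setOfPred_probabilityMeasure_mass_eq_compl_isCompact_le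
    (E := V → ℝ≥0) (u := fun _ => 0) (K := fun _ => E) tendsto_const_nhds (fun _ => hE)
    (Or.inr monotone_const)
  have hPS : ∀ n, P n ∈ {μ : ProbabilityMeasure (V → ℝ≥0) | ∀ _ : ℕ, μ Eᶜ ≤ 0} := by
    intro n _
    rw [nonpos_iff_eq_zero, ProbabilityMeasure.null_iff_toMeasure_null]
    exact hμE n
  obtain ⟨Q, hQS, hQ⟩ := hS.ultrafilter_le_nhds' ((hyperfilter ℕ).map P)
    (Ultrafilter.mem_map.2 (Filter.univ_mem' hPS))
  have hQ' : Tendsto P (hyperfilter ℕ : Filter ℕ) (𝓝 Q) := hQ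
  rw [ProbabilityMeasure.tendsto_iff_forall_integral_tendsto] at hQ'
  have hlim : ∀ (f : (V → ℝ≥0) → ℝ), Continuous f → ∀ C, (∀ a, |f a| ≤ C) →
      Tendsto (fun n => (hitMean G)^[n] f b₀) (hyperfilter ℕ : Filter ℕ)
        (𝓝 (∫ a, f a ∂(Q : Measure (V → ℝ≥0)))) := by
    intro f hf C hC
    have := hQ' (BoundedContinuousFunction.ofNormedAddCommGroup f hf C hC)
    refine this.congr fun n => ?_
    exact hint n f hf C hC
  refine ⟨(Q : Measure (V → ℝ≥0)), inferInstance, ?_, ?_⟩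
  · rw [isMeteorInvariant_iff]
    have := isProbabilityMeasure_hitStep (G := G) (μ := (Q : Measure (V → ℝ≥0)))
    refine measure_ext_of_lipschitz fun f ⟨C, hC⟩ ⟨L, hL⟩ => ?_
    rw [integral_hitStep hL.continuous hC]
    have h1 := hlim f hL.continuous C hC
    have h2 := hlim (hitMean G f) (continuous_hitMean hL.continuous 1) C (hitMean_bound hC 1)
    -- One extra initial hit only changes the starting point, which is forgotten. Thus a limit point
    -- of the laws themselves is invariant and no Cesàro means are needed.
    have h3 : Tendsto (fun n => (hitMean G)^[n] (hitMean G f) b₀ - (hitMean G)^[n] f b₀)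
        atTop (𝓝 0) := by
      rw [Metric.tendsto_atTop]
      intro ε hε
      obtain ⟨N, hN⟩ := exists_abs_hitMean_sub_le hG L.coe_nonneg (m := m)
        (fun a b _ _ => abs_sub_le_of_lipschitz hL a b) (half_pos hε)
      refine ⟨N, fun n hn => ?_⟩
      rw [Real.dist_0_eq_abs, ← Function.iterate_succ_apply, Function.iterate_succ_apply']
      refine lt_of_le_of_lt ?_ (half_lt_self hε)
      have e : hitMean G ((hitMean G)^[n] f) b₀ - (hitMean G)^[n] f b₀ =
          (∑ v, ((hitMean G)^[n] f (meteorHit G b₀ v) - (hitMean G)^[n] f b₀)) /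
            Fintype.card V := by
        rw [hitMean, Finset.sum_sub_distrib, sub_div]
        simp
      rw [e, abs_div, abs_of_pos hk, div_le_iff₀ hk]
      refine (Finset.abs_sum_le_sum_abs _ _).trans ((Finset.sum_le_sum fun u _ =>
        hN n hn _ _ ((sum_meteorHit hG b₀ u).trans hb₀) hb₀).trans_eq ?_)
      simp [mul_comm]
    have h4 := tendsto_nhds_unique (h2.sub h1) (h3.mono_left Nat.hyperfilter_le_atTop)
    linarith
  · have h := hQS 0
    rw [nonpos_iff_eq_zero, ProbabilityMeasure.null_iff_toMeasure_null] at h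
    exact h

end Existence

/-! ### From stationarity to invariance under hits. -/

section StationaryInvariant

open Filter Topology

variable {V : Type u} [Fintype V] [DecidableEq V] {G : SimpleGraph V} [DecidableRel G.Adj]

lemma IsPoissonProcess.hasLaw {Ω : Type u} [MeasurableSpace Ω] {μ : Measure Ω}
    {N : ℝ≥0 → Ω → ℕ} (h : IsPoissonProcess N μ) (t : ℝ≥0) :
    HasLaw (N t) (poissonMeasure t) μ := by
  have := h.law_increments 0 t zero_le
  rw [tsub_zero] at this
  refine this.congr ?_
  filter_upwards [h.start_zero] with ω hω
  simp [hω]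

variable {Ω : Type u} [MeasurableSpace Ω] {μ : Measure Ω}
  {N : V → ℝ≥0 → Ω → ℕ} {M : ℝ≥0 → Ω → V → ℝ≥0}

lemma IsMeteorProcess.measureReal_hits (h : IsMeteorProcess G μ N M) (t : ℝ≥0) (y : V → ℕ)
    {B : Set (V → ℝ≥0)} (hB : MeasurableSet B) :
    μ.real (M 0 ⁻¹' B ∩ (fun ω v => N v t ω) ⁻¹' {y}) =
      μ.real (M 0 ⁻¹' B) * ∏ v, (poissonMeasure t).real {y v} := by
  have := h.isProbabilityMeasure
  have hNm : ∀ v, Measurable (N v t) := fun v => (h.poisson v).measurable t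
  have hi : iIndepFun (fun v => N v t) μ :=
    h.indep.comp (fun _ n => n t) fun _ => measurable_pi_apply t
  have hX : IndepFun (M 0) (fun ω v => N v t ω) μ :=
    h.indep_start.comp (φ := id) (ψ := fun (n : V → ℝ≥0 → ℕ) v => n v t) measurable_id
      (by fun_prop)
  rw [measureReal_def, hX.measure_inter_preimage_eq_mul _ _ hB (measurableSet_singleton y),
    ENNReal.toReal_mul, ← measureReal_def]
  congr 1
  rw [← Measure.map_apply (by fun_prop) (measurableSet_singleton y),
    (iIndepFun_iff_map_fun_eq_pi_map fun v => (hNm v).aemeasurable).1 hi,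
    Measure.pi_singleton, ENNReal.toReal_prod]
  refine Finset.prod_congr rfl fun v _ => ?_
  rw [((h.poisson v).hasLaw t).map_eq, measureReal_def]

/-- Lower bound for the transition probabilities, from the events of at most one hit. -/
lemma IsMeteorProcess.le_measureReal (h : IsMeteorProcess G μ N M) (t : ℝ≥0)
    {B : Set (V → ℝ≥0)} (hB : MeasurableSet B) :
    Real.exp (-t) ^ Fintype.card V * (μ.real (M 0 ⁻¹' B) +
      t * ∑ v, μ.real (M 0 ⁻¹' ((fun a => meteorHit G a v) ⁻¹' B))) ≤ μ.real (M t ⁻¹' B) := by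
  have := h.isProbabilityMeasure
  have hNm : ∀ v, Measurable (N v t) := fun v => (h.poisson v).measurable t
  have hYm : Measurable fun ω v => N v t ω := by fun_prop
  -- `none` stands for no hit up to time `t`, and `some v` for a single hit, at `v`.
  let y : Option V → V → ℕ := fun o => o.elim 0 fun v => Pi.single v 1
  have hy : Function.Injective y := by
    rintro (_ | v) (_ | w) hvw
    · rfl
    · have := congrFun hvw w; simp [y] at this
    · have := congrFun hvw v; simp [y] at this
    · have := congrFun hvw v
      by_cases hne : v = w
      · rw [hne]
      · simp [y, hne] at this
  let C : Option V → Set (V → ℝ≥0) := fun o => o.elim B fun v => (fun a => meteorHit G a v) ⁻¹' B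
  have hC : ∀ o, MeasurableSet (C o) := by
    rintro (_ | v)
    · exact hB
    · exact measurable_meteorHit v hB
  let S : Option V → Set Ω := fun o => M 0 ⁻¹' C o ∩ (fun ω v => N v t ω) ⁻¹' {y o}
  have hSm : ∀ o, MeasurableSet (S o) := fun o =>
    (h.measurable 0 (hC o)).inter (hYm (measurableSet_singleton _))
  have hdisj : Pairwise (Function.onFun Disjoint S) := by
    intro o o' hoo
    refine Set.disjoint_left.2 fun ω h1 h2 => hoo (hy ?_)
    rw [← h1.2, ← h2.2]
  have hS0 : μ.real (S none) = μ.real (M 0 ⁻¹' B) * Real.exp (-t) ^ Fintype.card V := by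
    simp only [S]
    rw [h.measureReal_hits t _ (hC none)]
    simp [C, y, poissonMeasure_real_singleton]
  have hS1 : ∀ v, μ.real (S (some v)) = μ.real (M 0 ⁻¹' ((fun a => meteorHit G a v) ⁻¹' B)) *
      (Real.exp (-t) ^ Fintype.card V * t) := by
    intro v
    simp only [S]
    rw [h.measureReal_hits t _ (hC (some v))]
    congr 1
    have : ∀ w, (poissonMeasure t).real {y (some v) w} =
        Real.exp (-t) * if w = v then (t : ℝ) else 1 := by
      intro w
      by_cases hw : w = v
      · subst hw; simp [y, poissonMeasure_real_singleton]
      · simp [y, hw, poissonMeasure_real_singleton]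
    simp_rw [this, Finset.prod_mul_distrib]
    simp
  have hsub : (⋃ o, S o : Set Ω) ≤ᵐ[μ] M t ⁻¹' B := by
    have h0 : ∀ᵐ ω ∂μ, ∀ v, N v 0 ω = 0 := ae_all_iff.2 fun v => (h.poisson v).start_zero
    filter_upwards [h.no_hit, h.one_hit, h0] with ω h1 h2 h3 hω
    obtain ⟨o, ho⟩ := Set.mem_iUnion.1 hω
    have ho2 : ∀ v, N v t ω = y o v := fun v => congrFun ho.2 v
    rcases o with _ | v
    · have e : M t ω = M 0 ω := h1 0 t zero_le fun v => by rw [ho2, h3]; rfl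
      change M t ω ∈ B
      rw [e]; exact ho.1
    · have e : M t ω = meteorHit G (M 0 ω) v := h2 0 t zero_le v (by rw [ho2, h3]; simp [y])
        fun w hw => by rw [ho2, h3]; simp [y, hw]
      change M t ω ∈ B
      rw [e]; exact ho.1
  have hle : μ.real (⋃ o, S o) ≤ μ.real (M t ⁻¹' B) :=
    ENNReal.toReal_mono (measure_ne_top _ _) (measure_mono_ae hsub)
  rw [measureReal_iUnion_fintype hdisj hSm, Fintype.sum_option, hS0] at hle
  simp_rw [hS1, ← Finset.sum_mul] at hle
  linarith

/-- Stationary distributions are invariant under a hit at a uniformly chosen vertex. -/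
theorem IsMeteorStationary.isMeteorInvariant [Nonempty V] {Q : Measure (V → ℝ≥0)}
    (hQ : IsMeteorStationary G Q) : IsProbabilityMeasure Q ∧ IsMeteorInvariant G Q := by
  obtain ⟨Ω, _, μ, N, M, h, hlaw⟩ := hQ
  have := h.isProbabilityMeasure
  have hQp : IsProbabilityMeasure Q := (hlaw 0).isProbabilityMeasure_iff.1 inferInstance
  refine ⟨hQp, ?_⟩
  have hreal : ∀ t B, MeasurableSet B → μ.real (M t ⁻¹' B) = Q.real B := fun t B hB => by
    rw [← (hlaw t).map_eq, map_measureReal_apply (h.measurable t) hB]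
  have hk : (0 : ℝ) < Fintype.card V := by exact_mod_cast Fintype.card_pos
  -- In the short-time lower bound the terms `Q.real B` cancel to first order; dividing by `t` and
  -- letting `t → 0` leaves this inequality. Applied to complements, it yields the reverse one.
  have key : ∀ B, MeasurableSet B →
      ∑ v, Q.real ((fun a => meteorHit G a v) ⁻¹' B) ≤ Fintype.card V * Q.real B := by
    intro B hB
    set s := ∑ v, Q.real ((fun a => meteorHit G a v) ⁻¹' B) with hs
    have h1 : ∀ n : ℕ, Real.exp (-(1 / ((n : ℝ) + 1))) ^ Fintype.card V * s ≤
        Fintype.card V * Q.real B := by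
      intro n
      set t : ℝ≥0 := 1 / ((n : ℝ≥0) + 1) with ht
      have htr : (t : ℝ) = 1 / ((n : ℝ) + 1) := by simp [ht]
      have htpos : (0 : ℝ) < t := by rw [htr]; positivity
      have h2 := h.le_measureReal t hB
      simp only [hreal _ _ hB, hreal _ _ (measurable_meteorHit _ hB), ← hs] at h2
      rw [← htr]
      have h3 : 1 - Fintype.card V * (t : ℝ) ≤ Real.exp (-t) ^ Fintype.card V := by
        rw [← Real.exp_nat_mul]
        have := Real.add_one_le_exp ((Fintype.card V : ℝ) * (-t))
        linarith
      have h4 := mul_le_mul_of_nonneg_right h3 (measureReal_nonneg (μ := Q) (s := B))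
      have h5 : (t : ℝ) * (Real.exp (-t) ^ Fintype.card V * s) ≤
          t * (Fintype.card V * Q.real B) := by linarith
      exact le_of_mul_le_mul_left h5 htpos
    have h2 : Tendsto (fun n : ℕ => Real.exp (-(1 / ((n : ℝ) + 1))) ^ Fintype.card V * s) atTop
        (𝓝 (Real.exp (-0) ^ Fintype.card V * s)) :=
      (((Real.continuous_exp.tendsto _).comp
        tendsto_one_div_add_atTop_nhds_zero_nat.neg).pow _).mul_const _
    simp only [neg_zero, Real.exp_zero, one_pow, one_mul] at h2
    exact le_of_tendsto' h2 h1
  refine Measure.ext fun B hB => ?_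
  have h1 := key B hB
  have h2 := key Bᶜ hB.compl
  simp only [Set.preimage_compl] at h2
  rw [probReal_compl_eq_one_sub hB] at h2
  simp_rw [fun v => probReal_compl_eq_one_sub (μ := Q) (measurable_meteorHit (G := G) v hB)] at h2
  rw [Finset.sum_sub_distrib] at h2
  simp only [Finset.sum_const, Finset.card_univ, nsmul_eq_mul, mul_one] at h2
  have h3 : Fintype.card V * Q.real B = ∑ v, Q.real ((fun a => meteorHit G a v) ⁻¹' B) :=
    le_antisymm (by linarith) h1
  simp only [Measure.smul_apply, Measure.finsetSum_apply, smul_eq_mul]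
  rw [← ENNReal.toReal_eq_toReal_iff' (by finiteness)
    (ENNReal.sum_ne_top.2 fun _ _ => measure_ne_top _ _), ENNReal.toReal_mul,
    ENNReal.toReal_sum fun _ _ => measure_ne_top _ _]
  simp_rw [Measure.map_apply (measurable_meteorHit _) hB]
  simpa [measureReal_def] using h3

end StationaryInvariant

/-! ### Generating functions and product measures. -/

section PoissonTools

open Filter Topology

/-- The probability generating function of the Poisson distribution. -/
lemma integral_pow_poissonMeasure (r : ℝ≥0) (z : ℂ) :
    ∫ n, z ^ n ∂(poissonMeasure r) = Complex.exp (r * (z - 1)) := by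
  rw [integral_poissonMeasure r]
  calc ∑' n : ℕ, (Real.exp (-r) * r ^ n / (n.factorial : ℝ)) • z ^ n
      = ∑' n : ℕ, (Real.exp (-r) : ℂ) * ((r * z) ^ n / (n.factorial : ℂ)) := by
        congr with n
        rw [Complex.real_smul]
        push_cast
        rw [mul_pow]
        ring
    _ = Real.exp (-r) * ∑' n : ℕ, ((r * z) ^ n / (n.factorial : ℂ)) := tsum_mul_left
    _ = Real.exp (-r) * Complex.exp (r * z) := by
        rw [(NormedSpace.expSeries_div_hasSum_exp ((r : ℂ) * z)).tsum_eq, Complex.exp_eq_exp_ℂ]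
    _ = Complex.exp (r * (z - 1)) := by
        rw [Complex.ofReal_exp, ← Complex.exp_add]
        push_cast
        ring_nf

/-- Random variables whose joint probability generating function is that of independent Poisson
variables are independent Poisson variables. -/
lemma iIndepFun_poisson_of_integral_prod_pow {Ω ι : Type*} [MeasurableSpace Ω] [Fintype ι]
    {P : Measure Ω} [IsProbabilityMeasure P] {X : ι → Ω → ℕ} (hX : ∀ i, Measurable (X i))
    {r : ι → ℝ≥0} (h : ∀ z : ι → ℂ, (∀ i, ‖z i‖ = 1) →
      ∫ ω, ∏ i, z i ^ X i ω ∂P = ∏ i, Complex.exp (r i * (z i - 1))) :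
    iIndepFun X P ∧ ∀ i, HasLaw (X i) (poissonMeasure (r i)) P := by
  classical
  have hXr : ∀ i, Measurable fun ω => (X i ω : ℝ) := fun i => (measurable_of_countable _).comp (hX i)
  have hexp : ∀ t : ℝ, ‖Complex.exp (t * Complex.I)‖ = 1 := Complex.norm_exp_ofReal_mul_I
  -- On the unit circle the generating function is a characteristic function; putting `1` in the
  -- other variables isolates the marginal.
  have hmarg : ∀ i (t : ℝ), charFun (P.map fun ω => (X i ω : ℝ)) t =
      Complex.exp (r i * (Complex.exp (t * Complex.I) - 1)) := by
    intro i t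
    rw [charFun_apply_real, integral_map (hXr i).aemeasurable (by fun_prop)]
    have := h (Function.update (fun _ => 1) i (Complex.exp (t * Complex.I))) (fun j => by
      by_cases hj : j = i
      · subst hj; simp [hexp]
      · simp [hj])
    have e : ∀ ω, ∏ j, Function.update (fun _ => (1 : ℂ)) i (Complex.exp (t * Complex.I)) j ^ X j ω =
        Complex.exp (t * X i ω * Complex.I) := by
      intro ω
      rw [Finset.prod_eq_single i]
      · rw [Function.update_self, ← Complex.exp_nat_mul]
        congr 1; ring
      · intro j _ hj; simp [hj]
      · simp
    simp_rw [e] at this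
    push_cast
    rw [this, Finset.prod_eq_single i]
    · simp
    · intro j _ hj; simp [hj]
    · simp
  have hlaw : ∀ i, HasLaw (X i) (poissonMeasure (r i)) P := by
    intro i
    refine ⟨(hX i).aemeasurable, (MeasurableEmbedding.natCast (α := ℝ)).map_injective ?_⟩
    have : IsProbabilityMeasure (P.map (X i)) :=
      Measure.isProbabilityMeasure_map (hX i).aemeasurable
    have : IsProbabilityMeasure ((P.map (X i)).map (Nat.cast : ℕ → ℝ)) :=
      Measure.isProbabilityMeasure_map (measurable_of_countable _).aemeasurable
    have : IsProbabilityMeasure ((poissonMeasure (r i)).map (Nat.cast : ℕ → ℝ)) :=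
      Measure.isProbabilityMeasure_map (measurable_of_countable _).aemeasurable
    apply Measure.ext_of_charFun
    ext t
    rw [charFun_map_cast_poissonMeasure, Measure.map_map (measurable_of_countable _) (hX i)]
    exact hmarg i t
  refine ⟨?_, hlaw⟩
  have hind : iIndepFun (fun i ω => (X i ω : ℝ)) P := by
    rw [iIndepFun_iff_charFun_pi fun i => (hXr i).aemeasurable]
    intro t
    simp_rw [hmarg]
    have hm : Measurable fun ω => WithLp.toLp 2 (fun i => (X i ω : ℝ)) :=
      (MeasurableEquiv.toLp 2 (ι → ℝ)).measurable.comp (measurable_pi_lambda _ hXr)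
    rw [charFun_apply, integral_map hm.aemeasurable (by fun_prop),
      ← h (fun i => Complex.exp (t i * Complex.I)) fun i => hexp _]
    refine integral_congr_ae (ae_of_all _ fun ω => ?_)
    simp only [PiLp.inner_apply, Real.inner_apply]
    push_cast
    rw [Finset.sum_mul, Complex.exp_sum]
    refine Finset.prod_congr rfl fun i _ => ?_
    rw [← Complex.exp_nat_mul]
    congr 1; ring
  have := hind.comp (fun _ => Nat.floor) fun _ => Nat.measurable_floor
  simpa [Function.comp_def] using this

/-- Grouping of independent random variables. -/
lemma iIndepFun_curry {Ω ι κ E : Type*} [MeasurableSpace Ω] [MeasurableSpace E] {P : Measure Ω}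
    {X : ι → κ → Ω → E} (hX : ∀ i j, Measurable (X i j))
    (h : iIndepFun (fun (p : ι × κ) => X p.1 p.2) P) :
    iIndepFun (fun i ω j => X i j ω) P := by
  have := h.isProbabilityMeasure
  have hp : ∀ i j, IsProbabilityMeasure (P.map (X i j)) := fun i j =>
    Measure.isProbabilityMeasure_map (hX i j).aemeasurable
  rw [iIndepFun_iff_map_fun_eq_infinitePi_map fun i => measurable_pi_lambda _ (hX i)]
  have h1 : ∀ i, P.map (fun ω j => X i j ω) = Measure.infinitePi fun j => P.map (X i j) := by
    intro i
    have : iIndepFun (fun j => X i j) P :=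
      h.precomp (g := fun j => (i, j)) fun a b hab => (Prod.ext_iff.1 hab).2
    exact this.map_fun_eq_infinitePi_map (hX i)
  have hm : Measurable fun ω (p : ι × κ) => X p.1 p.2 ω :=
    measurable_pi_lambda _ fun p => hX p.1 p.2
  simp_rw [h1]
  rw [← Measure.infinitePi_map_curry fun i j => P.map (X i j),
    ← iIndepFun.map_fun_eq_infinitePi_map (X := fun p : ι × κ => X p.1 p.2)
      (fun p => hX p.1 p.2) h, Measure.map_map (MeasurableEquiv.measurable _) hm]
  rfl

/-- The expectation of a product of functions of different coordinates. -/
lemma integral_prod_infinitePi {ι κ X : Type*} [MeasurableSpace X] [Fintype κ]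
    (ν : ι → Measure X) [∀ i, IsProbabilityMeasure (ν i)] {g : κ → ι} (hg : Function.Injective g)
    {f : κ → X → ℂ} (hf : ∀ k, Measurable (f k)) :
    ∫ u, ∏ k, f k (u (g k)) ∂(Measure.infinitePi ν) = ∏ k, ∫ x, f k x ∂(ν (g k)) := by
  have h1 : iIndepFun (fun (i : ι) (u : ι → X) => u i) (Measure.infinitePi ν) :=
    iIndepFun_infinitePi (X := fun _ x => x) fun _ => measurable_id
  have h2 := (h1.precomp hg).comp f hf
  have h3 := h2.integral_fun_prod_eq_prod_integral fun k =>
    ((hf k).comp (measurable_pi_apply (g k))).aestronglyMeasurable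
  simp only [Function.comp_def] at h3
  rw [h3]
  refine Finset.prod_congr rfl fun k _ => ?_
  rw [← (measurePreserving_eval_infinitePi ν (g k)).map_eq,
    integral_map (measurable_pi_apply _).aemeasurable (hf k).aestronglyMeasurable]

/-- The first coordinate and the shifted sequence of a sequence of independent identically
distributed random variables. -/
lemma map_shift_infinitePi {X : Type*} [MeasurableSpace X] (ν : Measure X)
    [IsProbabilityMeasure ν] :
    (Measure.infinitePi fun _ : ℕ => ν).map (fun u => (u 0, fun i => u (i + 1))) =
      ν.prod (Measure.infinitePi fun _ : ℕ => ν) := by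
  have hm : Measurable fun p : X × (ℕ → X) => (fun i => Nat.casesOn i p.1 p.2 : ℕ → X) := by
    refine measurable_pi_lambda _ fun i => ?_
    cases i with
    | zero => exact measurable_fst
    | succ i => exact (measurable_pi_apply i).comp measurable_snd
  -- Prepending a coordinate inverts the shift, and its image measure can be checked on cylinders.
  have key : (ν.prod (Measure.infinitePi fun _ : ℕ => ν)).map
      (fun p => (fun i => Nat.casesOn i p.1 p.2 : ℕ → X)) = Measure.infinitePi fun _ : ℕ => ν := by
    refine Measure.eq_infinitePi _ fun s t ht => ?_
    classical
    set n := s.sup id + 1 with hn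
    have hs : s ⊆ Finset.range (n + 1) := fun i hi => by
      have : id i ≤ s.sup id := Finset.le_sup hi
      simp only [id] at this
      simp; omega
    let t' : ℕ → Set X := fun i => if i ∈ s then t i else Set.univ
    have ht' : ∀ i, MeasurableSet (t' i) := fun i => by
      by_cases hi : i ∈ s <;> simp [t', hi, ht]
    rw [Measure.map_apply hm (.pi s.countable_toSet fun i _ => ht i)]
    have e : (fun p : X × (ℕ → X) => (fun i => Nat.casesOn i p.1 p.2 : ℕ → X)) ⁻¹'
        (Set.pi s t) = t' 0 ×ˢ Set.pi (Finset.range n) fun i => t' (i + 1) := by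
      ext p
      simp only [Set.mem_preimage, Set.mem_pi, Set.mem_prod, Finset.mem_coe, Finset.mem_range]
      constructor
      · intro h
        refine ⟨?_, fun i _ => ?_⟩
        · by_cases h0 : 0 ∈ s
          · simpa [t', h0] using h 0 h0
          · simp [t', h0]
        · by_cases h0 : i + 1 ∈ s
          · simpa [t', h0] using h (i + 1) h0
          · simp [t', h0]
      · rintro ⟨h0, h1⟩ i hi
        cases i with
        | zero => simpa [t', hi] using h0
        | succ i =>
          have := h1 i (by have := hs hi; simp at this; omega)
          simpa [t', hi] using this
    rw [e, Measure.prod_prod, Measure.infinitePi_pi _ fun i _ => ht' _]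
    rw [mul_comm, ← Finset.prod_range_succ' (fun i => ν (t' i))]
    rw [← Finset.prod_subset hs fun i _ hi => by simp [t', hi]]
    exact Finset.prod_congr rfl fun i hi => by simp [t', hi]
  nth_rw 1 [← key]
  rw [Measure.map_map (by fun_prop) hm]
  exact Measure.map_id

end PoissonTools

/-! ### A Poisson arrival process built from unit intervals. -/

section Arrivals

open Filter Topology unitInterval

/-- Configurations of arrivals: for every `b`, a number of arrivals in `[b, b + 1]` and a sequence
that contains their positions relative to `b`. -/
abbrev ArrivalConfig := ℕ → ℕ × (ℕ → I)

/-- Poissonian numbers of independent uniformly distributed arrivals in the unit intervals. -/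
noncomputable def arrivalMeasure (r : ℝ≥0) : Measure ArrivalConfig :=
  Measure.infinitePi fun _ => (poissonMeasure r).prod (Measure.infinitePi fun _ => volume)

instance (r : ℝ≥0) : IsProbabilityMeasure (arrivalMeasure r) := by
  unfold arrivalMeasure; infer_instance

/-- The number of arrivals of the `b`-th unit interval that lie in `A`. -/
noncomputable def blockCount (A : Set ℝ) (b : ℕ) (p : ℕ × (ℕ → I)) : ℕ :=
  ∑ i ∈ Finset.range p.1, A.indicator (fun _ => 1) ((b : ℝ) + p.2 i)

/-- The number of arrivals of the first `m` unit intervals that lie in `A`. -/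
noncomputable def pointCount (A : Set ℝ) (m : ℕ) (ω : ArrivalConfig) : ℕ :=
  ∑ b ∈ Finset.range m, blockCount A b (ω b)

/-- The number of arrivals in `(0, t]`. -/
noncomputable def arrivalCount (t : ℝ≥0) (ω : ArrivalConfig) : ℕ :=
  pointCount (Set.Ioc 0 (t : ℝ)) (⌊t⌋₊ + 1) ω

lemma measurable_blockCount {A : Set ℝ} (hA : MeasurableSet A) (b : ℕ) :
    Measurable (blockCount A b) := by
  refine measurable_from_prod_countable_right fun c => ?_
  have h1 : Measurable (A.indicator fun _ => (1 : ℕ)) := measurable_const.indicator hA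
  have h2 : ∀ i, Measurable fun u : ℕ → I => A.indicator (fun _ => 1) ((b : ℝ) + u i) := fun i =>
    h1.comp (by fun_prop)
  exact Finset.measurable_fun_sum (Finset.range c) fun i _ => h2 i

lemma measurable_pointCount {A : Set ℝ} (hA : MeasurableSet A) (m : ℕ) :
    Measurable (pointCount A m) :=
  Finset.measurable_fun_sum _ fun b _ => (measurable_blockCount hA b).comp (measurable_pi_apply b)

lemma measurable_arrivalCount (t : ℝ≥0) : Measurable (arrivalCount t) :=
  measurable_pointCount measurableSet_Ioc _

/-- Blocks starting after `t` contribute nothing, so counts at several times can use a common number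
of blocks. -/
lemma arrivalCount_eq {t : ℝ≥0} {m : ℕ} (hm : ⌊t⌋₊ + 1 ≤ m) (ω : ArrivalConfig) :
    arrivalCount t ω = pointCount (Set.Ioc 0 (t : ℝ)) m ω := by
  refine Finset.sum_subset (Finset.range_subset_range.2 hm) fun b _ hb => ?_
  refine Finset.sum_eq_zero fun i _ => Set.indicator_of_notMem (fun h => ?_) _
  have h1 : (t : ℝ) < (⌊t⌋₊ + 1 : ℕ) := by exact_mod_cast Nat.lt_floor_add_one t
  have h2 : ((⌊t⌋₊ + 1 : ℕ) : ℝ) ≤ b := by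
    exact_mod_cast (by simpa using hb : ⌊t⌋₊ + 1 ≤ b)
  have h3 := ((ω b).2 i).2.1
  have h4 := h.2
  linarith

lemma arrivalCount_zero (ω : ArrivalConfig) : arrivalCount 0 ω = 0 := by
  simp [arrivalCount, pointCount, blockCount]

lemma pointCount_Ioc_add {s t : ℝ≥0} (hst : s ≤ t) (m : ℕ) (ω : ArrivalConfig) :
    pointCount (Set.Ioc 0 (s : ℝ)) m ω + pointCount (Set.Ioc (s : ℝ) t) m ω =
      pointCount (Set.Ioc 0 (t : ℝ)) m ω := by
  simp only [pointCount, blockCount, ← Finset.sum_add_distrib]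
  refine Finset.sum_congr rfl fun b _ => Finset.sum_congr rfl fun i _ => ?_
  have hst' : (s : ℝ) ≤ t := by exact_mod_cast hst
  rw [← Set.Ioc_union_Ioc_eq_Ioc s.coe_nonneg hst',
    Set.indicator_union_of_disjoint (Set.Ioc_disjoint_Ioc_of_le le_rfl)]

lemma arrivalCount_sub {s t : ℝ≥0} (hst : s ≤ t) {m : ℕ} (hm : ⌊t⌋₊ + 1 ≤ m) (ω : ArrivalConfig) :
    arrivalCount t ω - arrivalCount s ω = pointCount (Set.Ioc (s : ℝ) t) m ω := by
  have hs : ⌊s⌋₊ + 1 ≤ m := by have := Nat.floor_le_floor hst; omega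
  rw [arrivalCount_eq hm, arrivalCount_eq hs, ← pointCount_Ioc_add hst]
  omega

lemma arrivalCount_mono (ω : ArrivalConfig) : Monotone fun t => arrivalCount t ω := by
  intro s t hst
  have hs : ⌊s⌋₊ + 1 ≤ ⌊t⌋₊ + 1 := by have := Nat.floor_le_floor hst; omega
  beta_reduce
  rw [arrivalCount_eq (t := t) le_rfl, arrivalCount_eq (t := s) hs, ← pointCount_Ioc_add hst]
  omega

lemma arrivalCount_rightContinuous (ω : ArrivalConfig) (t : ℝ≥0) :
    ∀ᶠ s in 𝓝[≥] t, arrivalCount s ω = arrivalCount t ω := by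
  have h1 : ∀ᶠ s in 𝓝[≥] t, s < ((⌊t⌋₊ + 1 : ℕ) : ℝ≥0) :=
    nhdsWithin_le_nhds (Iio_mem_nhds (by exact_mod_cast Nat.lt_floor_add_one t))
  have h2 : ∀ᶠ s : ℝ≥0 in 𝓝[≥] t, ∀ b ∈ Finset.range (⌊t⌋₊ + 1), ∀ i ∈ Finset.range (ω b).1,
      (t : ℝ) < (b : ℝ) + (ω b).2 i → (s : ℝ) < (b : ℝ) + (ω b).2 i := by
    rw [Filter.eventually_all_finset]
    intro b _
    rw [Filter.eventually_all_finset]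
    intro i _
    by_cases h : (t : ℝ) < (b : ℝ) + (ω b).2 i
    · have : ∀ᶠ s : ℝ≥0 in 𝓝 t, (s : ℝ) < (b : ℝ) + (ω b).2 i :=
        NNReal.continuous_coe.tendsto t (Iio_mem_nhds h)
      filter_upwards [nhdsWithin_le_nhds this] with s hs _ using hs
    · exact Eventually.of_forall fun s h' => absurd h' h
  filter_upwards [h1, h2, self_mem_nhdsWithin] with s hs1 hs2 hs3
  have hts : (t : ℝ) ≤ s := by exact_mod_cast hs3
  have hfl : ⌊s⌋₊ + 1 ≤ ⌊t⌋₊ + 1 := by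
    have := (Nat.floor_lt zero_le).2 hs1
    omega
  rw [arrivalCount_eq hfl, arrivalCount]
  refine Finset.sum_congr rfl fun b hb => Finset.sum_congr rfl fun i hi => ?_
  by_cases h : (b : ℝ) + (ω b).2 i ∈ Set.Ioc 0 (t : ℝ)
  · have h' : (b : ℝ) + (ω b).2 i ∈ Set.Ioc 0 (s : ℝ) := ⟨h.1, h.2.trans hts⟩
    rw [Set.indicator_of_mem h, Set.indicator_of_mem h']
  · have h' : (b : ℝ) + (ω b).2 i ∉ Set.Ioc 0 (s : ℝ) := by
      rintro ⟨h3, h4⟩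
      refine h ⟨h3, ?_⟩
      by_contra h5
      exact absurd (hs2 b hb i hi (not_le.1 h5)) (not_lt.2 h4)
    rw [Set.indicator_of_notMem h, Set.indicator_of_notMem h']

/-- The length of the part of `(s, t]` in the `b`-th unit interval. -/
lemma volume_add_mem_Ioc (b : ℕ) {s t : ℝ} (hst : s ≤ t) :
    (volume : Measure I).real {u | (b : ℝ) + u ∈ Set.Ioc s t} =
      max 0 (min 1 (t - b)) - max 0 (min 1 (s - b)) := by
  have hIic : ∀ x : ℝ, (volume : Measure I).real {u | (b : ℝ) + u ≤ x} = max 0 (min 1 (x - b)) := by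
    intro x
    by_cases hx : x - b < 0
    · have : {u : I | (b : ℝ) + u ≤ x} = ∅ := by
        ext u
        have := u.2.1
        simp only [Set.mem_ofPred_eq, Set.mem_empty_iff_false, iff_false, not_le]
        linarith
      rw [this, measureReal_empty, max_eq_left]
      exact (min_le_right _ _).trans hx.le
    · have h0 : 0 ≤ min 1 (x - b) := le_min zero_le_one (not_lt.1 hx)
      have : {u : I | (b : ℝ) + u ≤ x} = Set.Iic ⟨min 1 (x - b), h0, min_le_left _ _⟩ := by
        ext u
        have := u.2.2
        simp only [Set.mem_ofPred_eq, Set.mem_Iic, ← Subtype.coe_le_coe, le_min_iff]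
        constructor
        · intro h; exact ⟨this, by linarith⟩
        · intro h; linarith [h.2]
      rw [this, measureReal_def, unitInterval.volume_Iic, ENNReal.toReal_ofReal h0, max_eq_right h0]
  have hm : ∀ x : ℝ, MeasurableSet {u : I | (b : ℝ) + u ≤ x} := fun x =>
    measurableSet_le (by fun_prop) measurable_const
  have e : {u : I | (b : ℝ) + u ∈ Set.Ioc s t} =
      {u : I | (b : ℝ) + u ≤ t} \ {u : I | (b : ℝ) + u ≤ s} := by
    ext u; simp [and_comm]
  have hsub : {u : I | (b : ℝ) + u ≤ s} ⊆ {u : I | (b : ℝ) + u ≤ t} :=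
    fun u (hu : (b : ℝ) + u ≤ s) => hu.trans hst
  rw [e, measureReal_sdiff hsub (hm s), hIic, hIic]

lemma sum_volume_add_mem_Ioc {s t : ℝ} (hs : 0 ≤ s) (hst : s ≤ t) {m : ℕ} (hm : t ≤ m) :
    ∑ b ∈ Finset.range m, (volume : Measure I).real {u | (b : ℝ) + u ∈ Set.Ioc s t} = t - s := by
  -- The lengths of the parts of `[0, x]` in the first `m` unit intervals add up to that of `[0, min
  -- x m]`.
  have h : ∀ (x : ℝ), 0 ≤ x → ∀ m : ℕ,
      ∑ b ∈ Finset.range m, max 0 (min 1 (x - b)) = min x m := by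
    intro x hx m
    induction m with
    | zero => simp [hx]
    | succ m ih =>
      rw [Finset.sum_range_succ, ih]
      push_cast
      rcases le_total x m with h1 | h1
      · rw [min_eq_left h1, min_eq_right (by linarith : x - m ≤ 1),
          max_eq_left (by linarith : x - m ≤ 0), min_eq_left (by linarith), add_zero]
      · rw [min_eq_right h1, max_eq_right (le_min zero_le_one (by linarith))]
        rcases le_total x (m + 1) with h2 | h2
        · rw [min_eq_left h2, min_eq_right (by linarith)]; ring
        · rw [min_eq_right h2, min_eq_left (by linarith)]
  simp_rw [volume_add_mem_Ioc _ hst]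
  rw [Finset.sum_sub_distrib, h t (hs.trans hst), h s hs, min_eq_left hm,
    min_eq_left (hst.trans hm)]

/-- The expectation of a product over the arrivals in a unit interval. -/
lemma integral_prod_block (r : ℝ≥0) {g : I → ℂ} (hg : Measurable g) (hg1 : ∀ u, ‖g u‖ ≤ 1) :
    ∫ p, ∏ i ∈ Finset.range p.1, g (p.2 i)
      ∂((poissonMeasure r).prod (Measure.infinitePi fun _ : ℕ => (volume : Measure I))) =
      Complex.exp (r * ((∫ u, g u) - 1)) := by
  have hm : Measurable fun p : ℕ × (ℕ → I) => ∏ i ∈ Finset.range p.1, g (p.2 i) :=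
    measurable_from_prod_countable_right fun c =>
      Finset.measurable_fun_prod (f := fun i (u : ℕ → I) => g (u i)) (Finset.range c)
        fun i _ => hg.comp (measurable_pi_apply i)
  rw [integral_prod _ (Integrable.of_bound hm.aestronglyMeasurable 1 (ae_of_all _ fun p => ?_))]
  -- Given the number `c` of arrivals, independence yields the `c`-th power of one integral;
  -- averaging over `c` is the Poisson generating function.
  · rw [← integral_pow_poissonMeasure]
    refine integral_congr_ae (ae_of_all _ fun c => ?_)
    have := integral_prod_infinitePi (fun _ : ℕ => (volume : Measure I))
      (Fin.val_injective (n := c)) (f := fun _ => g) fun _ => hg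
    simp only [Finset.prod_const, Finset.card_univ, Fintype.card_fin] at this
    beta_reduce
    rw [← this]
    simp only [Finset.prod_range]
  · rw [norm_prod]
    exact Finset.prod_le_one (fun _ _ => norm_nonneg _) fun _ _ => hg1 _

/-- At most one of the disjoint sets contains `x`; the sum form is what can be integrated termwise.
-/
lemma prod_pow_indicator {κ : Type*} [Fintype κ] {A : κ → Set ℝ}
    (hA : Pairwise (Function.onFun Disjoint A)) (z : κ → ℂ) (x : ℝ) :
    ∏ j, z j ^ (A j).indicator (fun _ => 1) x =
      1 + ∑ j, (z j - 1) * (A j).indicator (fun _ => (1 : ℂ)) x := by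
  classical
  by_cases h : ∃ j, x ∈ A j
  · obtain ⟨j, hj⟩ := h
    have h' : ∀ i, i ≠ j → x ∉ A i := fun i hi hx => Set.disjoint_left.1 (hA hi) hx hj
    rw [Finset.prod_eq_single j (fun i _ hi => by simp [h' i hi]) (by simp),
      Finset.sum_eq_single j (fun i _ hi => by simp [h' i hi]) (by simp)]
    simp [hj]
  · push Not at h
    simp [h]

/-- The joint probability generating function of the increments of the arrival process. -/
lemma integral_prod_pow_arrivalCount (r : ℝ≥0) {τ : ℕ → ℝ≥0} (hτ : Monotone τ) (n : ℕ)
    {z : Fin n → ℂ} (hz : ∀ j, ‖z j‖ ≤ 1) :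
    ∫ ω, ∏ j : Fin n, z j ^ (arrivalCount (τ (j + 1)) ω - arrivalCount (τ j) ω)
      ∂(arrivalMeasure r) =
      ∏ j : Fin n, Complex.exp (r * (τ (j + 1) - τ j : ℝ≥0) * (z j - 1)) := by
  set m := ⌊τ n⌋₊ + 1 with hm
  let A : Fin n → Set ℝ := fun j => Set.Ioc (τ j : ℝ) (τ (j + 1))
  have hle : ∀ j : Fin n, τ j ≤ τ (j + 1) := fun j => hτ (Nat.le_succ _)
  have hA : Pairwise (Function.onFun Disjoint A) := by
    intro i j hij
    rcases lt_or_gt_of_ne hij with h | h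
    · exact Set.Ioc_disjoint_Ioc_of_le (by exact_mod_cast hτ (Nat.succ_le_of_lt h))
    · exact (Set.Ioc_disjoint_Ioc_of_le (by exact_mod_cast hτ (Nat.succ_le_of_lt h))).symm
  have hfl : ∀ j : Fin n, ⌊τ (j + 1)⌋₊ + 1 ≤ m := fun j => by
    have : ⌊τ (j + 1)⌋₊ ≤ ⌊τ n⌋₊ := Nat.floor_le_floor (hτ j.2)
    omega
  have hφ : ∀ x, ‖∏ j, z j ^ (A j).indicator (fun _ => 1) x‖ ≤ 1 := fun x => by
    rw [norm_prod]
    refine Finset.prod_le_one (fun _ _ => norm_nonneg _) fun j _ => ?_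
    rw [norm_pow]
    exact pow_le_one₀ (norm_nonneg _) (hz j)
  have hφm : Measurable fun x : ℝ => ∏ j, z j ^ (A j).indicator (fun _ => 1) x :=
    Finset.measurable_fun_prod _ fun j _ => (measurable_of_countable (fun k : ℕ => z j ^ k)).comp
      (measurable_const.indicator measurableSet_Ioc)
  have h1 : ∀ ω : ArrivalConfig,
      ∏ j : Fin n, z j ^ (arrivalCount (τ (j + 1)) ω - arrivalCount (τ j) ω) =
      ∏ b : Fin m, ∏ i ∈ Finset.range (ω b).1,
        ∏ j, z j ^ (A j).indicator (fun _ => 1) ((b : ℝ) + (ω b).2 i) := by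
    intro ω
    simp_rw [fun j : Fin n => arrivalCount_sub (hle j) (hfl j) ω]
    simp only [pointCount, blockCount, ← Finset.prod_pow_eq_pow_sum]
    rw [Finset.prod_comm, Finset.prod_range]
    exact Finset.prod_congr rfl fun b _ => Finset.prod_comm
  simp_rw [h1]
  have hm2 : ∀ b : Fin m, Measurable fun p : ℕ × (ℕ → I) => ∏ i ∈ Finset.range p.1,
      ∏ j, z j ^ (A j).indicator (fun _ => 1) ((b : ℝ) + p.2 i) := fun b =>
    measurable_from_prod_countable_right fun c =>
      Finset.measurable_fun_prod (f := fun i (u : ℕ → I) =>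
        ∏ j, z j ^ (A j).indicator (fun _ => 1) ((b : ℝ) + u i)) (Finset.range c) fun i _ =>
        hφm.comp (f := fun u : ℕ → I => (b : ℝ) + u i) (by fun_prop)
  have h2 := integral_prod_infinitePi (fun _ : ℕ => (poissonMeasure r).prod
    (Measure.infinitePi fun _ : ℕ => (volume : Measure I))) (Fin.val_injective (n := m)) hm2
  rw [arrivalMeasure, h2]
  have h3 : ∀ b : ℕ, (∫ u : I, ∏ j, z j ^ (A j).indicator (fun _ => 1) ((b : ℝ) + u)) - 1 =
      ∑ j, (z j - 1) * (volume : Measure I).real {u | (b : ℝ) + u ∈ A j} := by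
    intro b
    have hms : ∀ j, MeasurableSet {u : I | (b : ℝ) + u ∈ A j} := fun j =>
      measurableSet_Ioc.preimage (f := fun u : I => (b : ℝ) + u) (by fun_prop)
    have hint : ∀ j, Integrable (fun u : I =>
        (z j - 1) * (A j).indicator (fun _ => (1 : ℂ)) ((b : ℝ) + u)) volume := fun j => by
      have : Integrable ({u : I | (b : ℝ) + u ∈ A j}.indicator fun _ => (1 : ℂ)) volume :=
        (integrable_const 1).indicator (hms j)
      exact this.const_mul (z j - 1)
    simp_rw [prod_pow_indicator hA]
    rw [integral_add (integrable_const _) (integrable_finsetSum _ fun j _ => hint j),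
      integral_finsetSum _ fun j _ => hint j]
    simp only [integral_const, probReal_univ, one_smul, add_sub_cancel_left]
    refine Finset.sum_congr rfl fun j _ => ?_
    rw [integral_const_mul]
    congr 1
    have := integral_indicator_const (μ := (volume : Measure I)) (1 : ℂ) (hms j)
    simp only [Complex.real_smul, mul_one] at this
    rw [← this]
    rfl
  have h4 : ∀ b : Fin m, ∫ p, ∏ i ∈ Finset.range p.1,
      ∏ j, z j ^ (A j).indicator (fun _ => 1) ((b : ℝ) + p.2 i)
      ∂((poissonMeasure r).prod (Measure.infinitePi fun _ : ℕ => (volume : Measure I))) =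
      Complex.exp (r * ∑ j, (z j - 1) * (volume : Measure I).real {u | (b : ℝ) + u ∈ A j}) := by
    intro b
    rw [← h3]
    exact integral_prod_block r (g := fun u : I => ∏ j, z j ^ (A j).indicator (fun _ => 1)
      ((b : ℝ) + u)) (hφm.comp (by fun_prop)) fun u => hφ _
  simp_rw [h4]
  rw [← Complex.exp_sum, ← Complex.exp_sum, ← Finset.mul_sum, Finset.sum_comm]
  congr 1
  rw [Finset.mul_sum]
  refine Finset.sum_congr rfl fun j _ => ?_
  have hmt : (τ (j + 1) : ℝ) ≤ m := by
    have h5 := Nat.lt_floor_add_one (τ n)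
    have h6 : τ (j + 1) ≤ τ n := hτ j.2
    exact_mod_cast (h6.trans h5.le)
  have h7 := sum_volume_add_mem_Ioc (τ j).coe_nonneg
    (by exact_mod_cast hle j : (τ j : ℝ) ≤ τ (j + 1)) hmt
  rw [← Finset.mul_sum, ← Complex.ofReal_sum,
    ← Finset.sum_range (fun b => (volume : Measure I).real {u | (b : ℝ) + u ∈ A j}), h7,
    ← NNReal.coe_sub (hle j)]
  ring

end Arrivals

/-! ### Recognising independent Poisson processes. -/

section PoissonFamily

open Filter Topology

lemma exists_monotone_finset_subset_range (J : Finset ℝ≥0) :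
    ∃ τ : ℕ → ℝ≥0, Monotone τ ∧ τ 0 = 0 ∧ ∃ n, ∀ t ∈ J, ∃ l ≤ n, τ l = t := by
  induction J using Finset.induction_on_max with
  | empty => exact ⟨fun _ => 0, monotone_const, rfl, 0, by simp⟩
  | insert a s hs ih =>
    obtain ⟨τ, hτ, h0, n, hn⟩ := ih
    refine ⟨fun l => if l ≤ n then min (τ l) a else a, ?_, by simp [h0], n + 1, ?_⟩
    · refine monotone_nat_of_le_succ fun l => ?_
      split_ifs with h1 h2 h2
      · exact min_le_min_right _ (hτ l.le_succ)
      · exact min_le_right _ _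
      · omega
      · exact le_rfl
    · intro t ht
      rcases Finset.mem_insert.1 ht with rfl | ht
      · exact ⟨n + 1, le_rfl, by simp⟩
      · obtain ⟨l, hl, rfl⟩ := hn t ht
        exact ⟨l, by omega, by simp [hl, (hs _ ht).le]⟩

/-- A family of counting processes whose increments have the joint probability generating function
of independent Poisson processes is a family of independent Poisson processes. -/
lemma isPoissonProcess_of_integral_prod_pow {Ω : Type u} [MeasurableSpace Ω] {P : Measure Ω}
    [IsProbabilityMeasure P] {K : Type*} [Fintype K] {N : K → ℝ≥0 → Ω → ℕ}
    (hmeas : ∀ i t, Measurable (N i t)) (h0 : ∀ i ω, N i 0 ω = 0)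
    (hmono : ∀ i ω, Monotone fun t => N i t ω)
    (hright : ∀ i ω t, ∀ᶠ s in 𝓝[≥] t, N i s ω = N i t ω)
    (h : ∀ τ : ℕ → ℝ≥0, Monotone τ → ∀ (n : ℕ) (z : K × Fin n → ℂ), (∀ p, ‖z p‖ = 1) →
      ∫ ω, ∏ p, z p ^ (N p.1 (τ (p.2 + 1)) ω - N p.1 (τ p.2) ω) ∂P =
        ∏ p : K × Fin n, Complex.exp ((τ (p.2 + 1) - τ p.2 : ℝ≥0) * (z p - 1))) :
    (∀ i, IsPoissonProcess (N i) P) ∧ iIndepFun (fun i ω t => N i t ω) P := by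
  have hinc : ∀ τ : ℕ → ℝ≥0, Monotone τ → ∀ n : ℕ,
      iIndepFun (fun (p : K × Fin n) ω => N p.1 (τ (p.2 + 1)) ω - N p.1 (τ p.2) ω) P ∧
      ∀ p : K × Fin n, HasLaw (fun ω => N p.1 (τ (p.2 + 1)) ω - N p.1 (τ p.2) ω)
        (poissonMeasure (τ (p.2 + 1) - τ p.2)) P := fun τ hτ n =>
    iIndepFun_poisson_of_integral_prod_pow
      (X := fun (p : K × Fin n) ω => N p.1 (τ (p.2 + 1)) ω - N p.1 (τ p.2) ω)
      (fun p => (hmeas _ _).sub (hmeas _ _)) (r := fun p => τ (p.2 + 1) - τ p.2)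
      (h τ hτ n)
  refine ⟨fun i => ⟨hmeas i, ae_of_all _ (h0 i), ae_of_all _ (hmono i), ae_of_all _ fun ω t => ?_,
    fun n t ht => ?_, fun s t hst => ?_⟩, iIndepFun.iIndepFun_process hmeas fun I J => ?_⟩
  · refine Tendsto.congr' ?_ tendsto_const_nhds (f₁ := fun _ => N i t ω)
    filter_upwards [hright i ω t] with s hs using hs.symm
  · let τ : ℕ → ℝ≥0 := fun j => t ⟨min j n, by omega⟩
    have hτ : Monotone τ := fun a b hab => ht (by simp only [Fin.mk_le_mk]; omega)
    have := (hinc τ hτ n).1.precomp (g := fun j : Fin n => (i, j)) fun a b hab => by simpa using hab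
    convert this using 5 with j ω
    · simp only [τ]
      congr 1
      ext
      simp only [Fin.val_succ]
      omega
    · simp only [τ]
      congr 1
      ext
      simp only [Fin.val_castSucc]
      omega
  · let τ : ℕ → ℝ≥0 := fun j => if j = 0 then s else t
    have hτ : Monotone τ := monotone_nat_of_le_succ fun j => by
      simp only [τ]; split_ifs <;> simp_all
    simpa [τ] using (hinc τ hτ 1).2 (i, 0)
  · classical
    -- All times involved are put on one grid starting at `0`. Each count is then a partial sum of
    -- grid increments, whose independence over all indices is grouped by process.
    obtain ⟨τ, hτ, hτ0, n, hn⟩ := exists_monotone_finset_subset_range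
      (Finset.univ.biUnion fun i : I => J i)
    have hn' : ∀ (i : I) (t : J i), ∃ l ≤ n, τ l = t := fun i t =>
      hn t (Finset.mem_biUnion.2 ⟨i, Finset.mem_univ _, t.2⟩)
    choose l hl hτl using hn'
    have h1 := (iIndepFun_curry
      (X := fun (i : K) (j : Fin n) ω => N i (τ (j + 1)) ω - N i (τ j) ω)
      (fun i j => (hmeas _ _).sub (hmeas _ _)) (hinc τ hτ n).1).precomp
      (g := fun i : I => (i : K)) Subtype.val_injective
    have h2 := h1.comp (fun i (x : Fin n → ℕ) (t : J i) =>
      ∑ j : Fin n, if (j : ℕ) < l i t then x j else 0) fun i => by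
        refine measurable_pi_lambda _ fun t => Finset.measurable_fun_sum _ fun j _ => ?_
        split_ifs
        · exact measurable_pi_apply j
        · exact measurable_const
    convert h2 using 4 with i ω t
    simp only [Function.comp_apply]
    have key : ∀ m, ∑ j ∈ Finset.range m, (N i (τ (j + 1)) ω - N i (τ j) ω) = N i (τ m) ω := by
      intro m
      rw [Finset.sum_range_tsub (f := fun j => N i (τ j) ω) fun a b hab => hmono i ω (hτ hab),
        hτ0, h0, tsub_zero]
    rw [← hτl i t, ← key, Finset.sum_fin_eq_sum_range]
    rw [← Finset.sum_subset (Finset.range_subset_range.2 (hl i t))]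
    · refine Finset.sum_congr rfl fun j hj => ?_
      have := Finset.mem_range.1 hj
      have := hl i t
      simp [show j < n by omega, *]
    · intro j hj hj'
      simp_all

end PoissonFamily

/-! ### Splitting arrivals by independent uniform marks. -/

section Marks

variable {K : Type u} [Fintype K] [Nonempty K] [MeasurableSpace K] [MeasurableSingletonClass K]

variable (K) in
/-- The uniform distribution on a finite set of marks. -/
noncomputable def markMeasure : Measure K := (PMF.uniformOfFintype K).toMeasure

instance : IsProbabilityMeasure (markMeasure K) := by
  unfold markMeasure; infer_instance

lemma integral_markMeasure (f : K → ℂ) :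
    ∫ x, f x ∂(markMeasure K) = (∑ x, f x) / Fintype.card K := by
  rw [markMeasure, PMF.integral_eq_sum, div_eq_inv_mul, Finset.mul_sum]
  simp

variable (K) in
/-- The distribution of arrivals with rate `|K|` and independent uniform marks. -/
noncomputable def markedMeasure : Measure (ArrivalConfig × (ℕ → K)) :=
  (arrivalMeasure (Fintype.card K)).prod (Measure.infinitePi fun _ => markMeasure K)

instance : IsProbabilityMeasure (markedMeasure K) := by
  unfold markedMeasure; infer_instance

variable [DecidableEq K]

/-- The number of arrivals with mark `i` in `(0, t]`. -/
noncomputable def markedCount (i : K) (t : ℝ≥0) (p : ArrivalConfig × (ℕ → K)) : ℕ :=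
  ∑ j ∈ Finset.range (arrivalCount t p.1), if p.2 j = i then 1 else 0

omit [Fintype K] [Nonempty K] in
lemma measurable_markedCount (i : K) (t : ℝ≥0) : Measurable (markedCount i t) := by
  have h : Measurable fun q : ℕ × (ℕ → K) => ∑ j ∈ Finset.range q.1, if q.2 j = i then 1 else 0 :=
    measurable_from_prod_countable_right fun c => Finset.measurable_fun_sum
      (f := fun j (u : ℕ → K) => if u j = i then 1 else 0) (Finset.range c) fun j _ =>
      Measurable.ite ((measurableSet_singleton i).preimage (measurable_pi_apply j)) measurable_const
        measurable_const
  exact h.comp (((measurable_arrivalCount t).comp measurable_fst).prodMk measurable_snd)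

omit [Fintype K] [Nonempty K] [MeasurableSpace K] [MeasurableSingletonClass K] in
lemma markedCount_mono (i : K) (p : ArrivalConfig × (ℕ → K)) :
    Monotone fun t => markedCount i t p := fun _ _ hst =>
  Finset.sum_le_sum_of_subset (Finset.range_subset_range.2 (arrivalCount_mono p.1 hst))

omit [Nonempty K] [MeasurableSpace K] [MeasurableSingletonClass K] in
lemma sum_markedCount (t : ℝ≥0) (p : ArrivalConfig × (ℕ → K)) :
    ∑ i, markedCount i t p = arrivalCount t p.1 := by
  simp only [markedCount]
  rw [Finset.sum_comm]
  simp

/-- The joint probability generating function of the increments of the numbers of arrivals with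
given marks. -/
lemma integral_prod_pow_markedCount {τ : ℕ → ℝ≥0} (hτ : Monotone τ) (n : ℕ)
    {z : K × Fin n → ℂ} (hz : ∀ p, ‖z p‖ = 1) :
    ∫ ω, ∏ p : K × Fin n, z p ^ (markedCount p.1 (τ (p.2 + 1)) ω - markedCount p.1 (τ p.2) ω)
      ∂(markedMeasure K) =
      ∏ p : K × Fin n, Complex.exp ((τ (p.2 + 1) - τ p.2 : ℝ≥0) * (z p - 1)) := by
  have hm : Measurable fun ω : ArrivalConfig × (ℕ → K) => ∏ p : K × Fin n,
      z p ^ (markedCount p.1 (τ (p.2 + 1)) ω - markedCount p.1 (τ p.2) ω) :=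
    Finset.measurable_fun_prod _ fun p _ =>
      (measurable_of_countable fun k : ℕ => z p ^ k).comp
        ((measurable_markedCount _ _).sub (measurable_markedCount _ _))
  rw [markedMeasure, integral_prod _ (Integrable.of_bound hm.aestronglyMeasurable 1
    (ae_of_all _ fun ω => by simp [hz]))]
  have hcard : (Fintype.card K : ℂ) ≠ 0 := by simp
  have h1 : ∀ ω : ArrivalConfig, ∫ u, ∏ p : K × Fin n, z p ^ (markedCount p.1 (τ (p.2 + 1)) (ω, u) -
      markedCount p.1 (τ p.2) (ω, u)) ∂(Measure.infinitePi fun _ => markMeasure K) =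
      ∏ j : Fin n, ((∑ i, z (i, j)) / Fintype.card K) ^
        (arrivalCount (τ (j + 1)) ω - arrivalCount (τ j) ω) := by
    intro ω
    let c : ℕ → ℕ := fun j => arrivalCount (τ j) ω
    have hc : Monotone c := (arrivalCount_mono ω).comp hτ
    let d : Fin n → ℕ := fun j => c (j + 1) - c j
    -- Index of the mark of an arrival in the `j`-th time interval. Distinct arrivals use distinct
    -- marks, so given the arrivals each contributes the mean of `z (·, j)` independently.
    let g : (Σ j : Fin n, Fin (d j)) → ℕ := fun q => c q.1 + q.2
    have hg : Function.Injective g := by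
      rintro ⟨j, a⟩ ⟨j', a'⟩ heq
      have ha := a.2
      have ha' := a'.2
      simp only [g, d] at heq ha ha'
      have hjj : j = j' := by
        by_contra hne
        rcases lt_or_gt_of_ne hne with hlt | hlt
        · have := hc (Nat.succ_le_of_lt (Fin.lt_def.1 hlt))
          simp only [Nat.succ_eq_add_one] at this
          omega
        · have := hc (Nat.succ_le_of_lt (Fin.lt_def.1 hlt))
          simp only [Nat.succ_eq_add_one] at this
          omega
      subst hjj
      have : (a : ℕ) = a' := by omega
      rw [Fin.ext this]
    have h2 := integral_prod_infinitePi (fun _ : ℕ => markMeasure K) hg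
      (f := fun q x => z (x, q.1)) fun q => measurable_of_countable _
    simp only [integral_markMeasure] at h2
    rw [Fintype.prod_sigma] at h2
    simp only [Finset.prod_const, Finset.card_univ, Fintype.card_fin] at h2
    refine Eq.trans (integral_congr_ae (ae_of_all _ fun u => ?_)) h2
    beta_reduce
    rw [Fintype.prod_prod_type_right, Fintype.prod_sigma]
    refine Finset.prod_congr rfl fun j _ => ?_
    have h3 : ∀ i, markedCount i (τ (j + 1)) (ω, u) - markedCount i (τ j) (ω, u) =
        ∑ a : Fin (d j), if u (c j + a) = i then 1 else 0 := by
      intro i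
      have h4 : c (j + 1) = c j + d j := (Nat.add_sub_cancel' (hc (Nat.le_succ _))).symm
      simp only [markedCount]
      change ∑ a ∈ Finset.range (c (j + 1)), _ - ∑ a ∈ Finset.range (c j), _ = _
      rw [h4, Finset.sum_range_add, Nat.add_sub_cancel_left,
        Finset.sum_range (fun a => if u (c j + a) = i then 1 else 0)]
    simp only [h3, ← Finset.prod_pow_eq_pow_sum]
    rw [Finset.prod_comm]
    refine Finset.prod_congr rfl fun a _ => ?_
    simp [g, pow_ite]
  simp only [h1]
  rw [integral_prod_pow_arrivalCount _ hτ n]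
  · rw [Fintype.prod_prod_type_right]
    refine Finset.prod_congr rfl fun j _ => ?_
    -- The rate `|K|` cancels the mean over marks, so the exponential factorises over `K` with rate
    -- one each.
    rw [← Complex.exp_sum]
    dsimp only
    rw [← Finset.mul_sum, Finset.sum_sub_distrib]
    congr 1
    push_cast
    field_simp
    simp
  · intro j
    rw [norm_div, Complex.norm_natCast, div_le_one (by positivity)]
    exact (norm_sum_le _ _).trans (by simp [hz])

end Marks

/-! ### The stationary process with a given invariant law. -/

section Construction

open Function

variable {V : Type u} [Fintype V] [DecidableEq V] {G : SimpleGraph V} [DecidableRel G.Adj]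

variable (G) in
/-- Apply the hit prescribed by the first element of a sequence and delete this element. -/
noncomputable def consumeHit (p : (V → ℝ≥0) × (ℕ → V)) : (V → ℝ≥0) × (ℕ → V) :=
  (meteorHit G p.1 (p.2 0), fun i => p.2 (i + 1))

lemma consumeHit_iterate_snd (n : ℕ) (p : (V → ℝ≥0) × (ℕ → V)) :
    ((consumeHit G)^[n] p).2 = fun i => p.2 (i + n) := by
  induction n with
  | zero => rfl
  | succ n ih =>
    rw [iterate_succ_apply', consumeHit, ih]
    ext i
    simp only [add_assoc, add_comm 1]

lemma consumeHit_iterate_succ_fst (n : ℕ) (p : (V → ℝ≥0) × (ℕ → V)) :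
    ((consumeHit G)^[n + 1] p).1 = meteorHit G ((consumeHit G)^[n] p).1 (p.2 n) := by
  simp [iterate_succ_apply', consumeHit, consumeHit_iterate_snd]

variable [MeasurableSpace V] [MeasurableSingletonClass V]

lemma measurable_consumeHit : Measurable (consumeHit G) := by
  have h : Measurable fun q : V × (V → ℝ≥0) => meteorHit G q.2 q.1 :=
    measurable_from_prod_countable_right fun v => measurable_meteorHit v
  have h1 : Measurable fun p : (V → ℝ≥0) × (ℕ → V) => (p.2 0, p.1) := by fun_prop
  have h2 : Measurable fun p : (V → ℝ≥0) × (ℕ → V) => fun i => p.2 (i + 1) := by fun_prop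
  exact (h.comp h1).prodMk h2

variable [Nonempty V] {Q : Measure (V → ℝ≥0)} [IsProbabilityMeasure Q]

lemma IsMeteorInvariant.map_meteorHit_prod (hQ : IsMeteorInvariant G Q) :
    (Q.prod (markMeasure V)).map (fun p => meteorHit G p.1 p.2) = Q := by
  have hm : Measurable fun p : (V → ℝ≥0) × V => meteorHit G p.1 p.2 :=
    measurable_from_prod_countable_left fun v => measurable_meteorHit v
  ext A hA
  rw [Measure.map_apply hm hA, Measure.prod_apply_symm (hm hA), markMeasure, lintegral_fintype]
  have h := congrArg (fun μ : Measure (V → ℝ≥0) => μ A) hQ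
  simp only [Measure.smul_apply, Measure.finsetSum_apply, smul_eq_mul] at h
  have h2 : ∀ v, Q ((fun a => (a, v)) ⁻¹' ((fun p : (V → ℝ≥0) × V => meteorHit G p.1 p.2) ⁻¹' A)) =
      Q.map (fun a => meteorHit G a v) A := fun v => by
    rw [Measure.map_apply (measurable_meteorHit v) hA]; rfl
  simp only [h2, PMF.toMeasure_apply_singleton _ _ (measurableSet_singleton _),
    PMF.uniformOfFintype_apply]
  rw [← Finset.sum_mul, ← h, mul_comm, ← mul_assoc, ENNReal.inv_mul_cancel (by simp) (by simp),
    one_mul]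

/-- The first mark is spent on the configuration, whose law is preserved, while the unused marks
remain independent of it and identically distributed. -/
lemma IsMeteorInvariant.measurePreserving_consumeHit (hQ : IsMeteorInvariant G Q) :
    MeasurePreserving (consumeHit G) (Q.prod (Measure.infinitePi fun _ => markMeasure V))
      (Q.prod (Measure.infinitePi fun _ => markMeasure V)) := by
  have hm : Measurable fun p : (V → ℝ≥0) × V => meteorHit G p.1 p.2 :=
    measurable_from_prod_countable_left fun v => measurable_meteorHit v
  have h1 : MeasurePreserving (fun u : ℕ → V => (u 0, fun i => u (i + 1)))
      (Measure.infinitePi fun _ => markMeasure V)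
      ((markMeasure V).prod (Measure.infinitePi fun _ => markMeasure V)) :=
    ⟨by fun_prop, map_shift_infinitePi _⟩
  have h2 := ((MeasurePreserving.mk hm hQ.map_meteorHit_prod).prod
    (MeasurePreserving.id (Measure.infinitePi fun _ : ℕ => markMeasure V))).comp
    ((measurePreserving_prodAssoc Q (markMeasure V)
      (Measure.infinitePi fun _ : ℕ => markMeasure V)).symm.comp
      ((MeasurePreserving.id Q).prod h1))
  exact h2

variable (G) in
/-- The configuration at time `t` when the arrivals are hits whose marks are the vertices hit. -/
noncomputable def markedMeteor (t : ℝ≥0) (p : (V → ℝ≥0) × (ArrivalConfig × (ℕ → V))) :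
    V → ℝ≥0 :=
  ((consumeHit G)^[arrivalCount t p.2.1] (p.1, p.2.2)).1

omit [Nonempty V] in
lemma measurable_markedMeteor (t : ℝ≥0) : Measurable (markedMeteor G t) := by
  have h : Measurable fun q : ℕ × ((V → ℝ≥0) × (ℕ → V)) => (consumeHit G)^[q.1] q.2 :=
    measurable_from_prod_countable_right fun n => measurable_consumeHit.iterate n
  exact measurable_fst.comp (h.comp (((measurable_arrivalCount t).comp
    (measurable_fst.comp measurable_snd)).prodMk
    (measurable_fst.prodMk (measurable_snd.comp measurable_snd))))

/-- Given the arrivals, the number of hits is fixed and each preserves the joint law of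
configuration and marks; a skew product makes the conditioning precise. -/
lemma IsMeteorInvariant.hasLaw_markedMeteor (hQ : IsMeteorInvariant G Q) (t : ℝ≥0) :
    HasLaw (markedMeteor G t) Q (Q.prod (markedMeasure V)) := by
  set ν := Measure.infinitePi fun _ : ℕ => markMeasure V
  set α := arrivalMeasure (Fintype.card V)
  have h : Measurable fun q : ℕ × ((V → ℝ≥0) × (ℕ → V)) => (consumeHit G)^[q.1] q.2 :=
    measurable_from_prod_countable_right fun n => measurable_consumeHit.iterate n
  have h1 : MeasurePreserving
      (fun p : ArrivalConfig × ((V → ℝ≥0) × (ℕ → V)) =>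
        (id p.1, (consumeHit G)^[arrivalCount t p.1] p.2)) (α.prod (Q.prod ν)) (α.prod (Q.prod ν)) :=
    (MeasurePreserving.id α).skew_product
      (g := fun ω p => (consumeHit G)^[arrivalCount t ω] p)
      (h.comp (((measurable_arrivalCount t).comp measurable_fst).prodMk measurable_snd))
      (ae_of_all _ fun ω => (hQ.measurePreserving_consumeHit.iterate _).map_eq)
  have h2 := (measurePreserving_prodAssoc α Q ν).comp
    (((Measure.measurePreserving_swap (μ := Q) (ν := α)).prod (MeasurePreserving.id ν)).comp
      (measurePreserving_prodAssoc Q α ν).symm)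
  have h3 := (measurePreserving_fst (μ := Q) (ν := ν)).comp
    ((measurePreserving_snd (μ := α) (ν := Q.prod ν)).comp (h1.comp h2))
  exact ⟨(measurable_markedMeteor t).aemeasurable, h3.map_eq⟩

lemma isMeteorProcess_markedMeteor :
    IsMeteorProcess G (Q.prod (markedMeasure V)) (fun v t p => markedCount v t p.2)
      (markedMeteor G) := by
  have hN : ∀ v t, Measurable fun p : (V → ℝ≥0) × (ArrivalConfig × (ℕ → V)) =>
      markedCount v t p.2 := fun v t => (measurable_markedCount v t).comp measurable_snd
  have hcount : ∀ (t : ℝ≥0) (p : (V → ℝ≥0) × (ArrivalConfig × (ℕ → V))),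
      arrivalCount t p.2.1 = ∑ v, markedCount v t p.2 := fun t p => (sum_markedCount t p.2).symm
  obtain ⟨h1, h2⟩ := isPoissonProcess_of_integral_prod_pow (P := Q.prod (markedMeasure V))
    (N := fun v t p => markedCount v t p.2) hN
    (fun v p => by simp [markedCount, arrivalCount_zero])
    (fun v p => markedCount_mono v p.2)
    (fun v p t => by
      filter_upwards [arrivalCount_rightContinuous p.2.1 t] with s hs
      simp only [markedCount, hs])
    (fun τ hτ n z hz => by
      rw [integral_fun_snd (fun ω => ∏ p : V × Fin n,
        z p ^ (markedCount p.1 (τ (p.2 + 1)) ω - markedCount p.1 (τ p.2) ω)),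
        integral_prod_pow_markedCount hτ n hz]
      simp)
  refine ⟨inferInstance, h1, h2, measurable_markedMeteor, ?_, ae_of_all _ fun p s t _ h => ?_,
    ae_of_all _ fun p s t hst v hv hw => ?_⟩
  · have h0 : markedMeteor G 0 = fun p : (V → ℝ≥0) × (ArrivalConfig × (ℕ → V)) => p.1 := by
      ext1 p
      simp [markedMeteor, arrivalCount_zero]
    rw [h0]
    exact indepFun_prod (X := id) (Y := fun ω v t => markedCount v t ω) measurable_id
      (measurable_pi_lambda _ fun v => measurable_pi_lambda _ fun t => measurable_markedCount v t)
  · simp only [markedMeteor, hcount, h]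
  · have hsucc : arrivalCount t p.2.1 = arrivalCount s p.2.1 + 1 := by
      rw [hcount, hcount, ← Finset.add_sum_erase _ _ (Finset.mem_univ v),
        ← Finset.add_sum_erase _ (fun v => markedCount v s p.2) (Finset.mem_univ v), hv,
        Finset.sum_congr rfl fun w hw' => hw w (Finset.ne_of_mem_erase hw')]
      omega
    -- Marks are indexed from `0`, so the single new arrival uses the mark at the old count; any
    -- other value would leave the count of `v` unchanged.
    have hmark : p.2.2 (arrivalCount s p.2.1) = v := by
      by_contra hne
      rw [markedCount, hsucc, Finset.sum_range_succ, if_neg hne] at hv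
      simp [markedCount] at hv
    rw [markedMeteor, hsucc, consumeHit_iterate_succ_fst, hmark]
    rfl

end Construction

lemma IsMeteorInvariant.isMeteorStationary {V : Type u} [Fintype V] [DecidableEq V] [Nonempty V]
    {G : SimpleGraph V} [DecidableRel G.Adj] {Q : Measure (V → ℝ≥0)} [IsProbabilityMeasure Q]
    (hQ : IsMeteorInvariant G Q) : IsMeteorStationary G Q := by
  let _ : MeasurableSpace V := ⊤
  exact ⟨_, _, _, _, _, isMeteorProcess_markedMeteor, hQ.hasLaw_markedMeteor⟩

theorem mainTheorem6 {V : Type u} [Fintype V] [DecidableEq V] [Nontrivial V]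
    (G : SimpleGraph V) [DecidableRel G.Adj] (hG : G.Connected) :
    ∃ Q : Measure (V → ℝ≥0),
      (IsNormalizedMeteorStationary G Q ∧
        ∀ Q' : Measure (V → ℝ≥0), IsNormalizedMeteorStationary G Q' → Q' = Q) ∧
      Q.support = {a | ∑ x, a x = (Fintype.card V : ℝ≥0) ∧ ∃ x, a x = 0} := by
  obtain ⟨Q, hprob, hQ, hmass⟩ := exists_isMeteorInvariant hG
  refine ⟨Q, ⟨⟨hQ.isMeteorStationary, hmass⟩, fun Q' ⟨hQ', hmass'⟩ => ?_⟩,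
    hQ.support_eq hG hmass⟩
  obtain ⟨hprob', hinv'⟩ := hQ'.isMeteorInvariant
  exact hinv'.unique hG hQ hmass' hmass
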